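/- A topological groupoid $\mathcal G$ with unit space $\mathcal G^{(0)}$, source map $d$ and range map $r$ is called *ample* if it is étale (that is, $d:\mathcal G\to\mathcal G^{(0)}$ is a local homeomorphism) and its topology has a basis of compact open bisections, a bisection being a set on which $d$ and $r$ restrict to homeomorphisms onto their images. Its orbit space is the set of orbits in $\mathcal G^{(0)}$ with the quotient topology. An *inverse semigroup with zero* is a semigroup with zero in which every $s$ has a unique $s^*$ with $ss^*s=s$ and $s^*ss^*=s^*$; its natural order is given by $s\le t$ iff $s^*s\le t^*t$ and $t\,s^*s=s$ (where $e\le f$ means $ef=e$ for idempotents); $s,t$ are orthogonal if $st^*=0=s^*t$. It is a *Boolean inverse semigroup* if its idempotents form a generalized Boolean algebra and finite families of pairwise orthogonal elements have joins. A *morphism* of Boolean inverse semigroups is a semigroup homomorphism preserving joins of finite orthogonal families (in particular $0$). We say that $S$ has $B$ as a *subquotient* if there are a Boolean inverse subsemigroup $C\subseteq S$ (a subset containing $0$ and closed under products, inverses, relative complements of idempotents and joins of orthogonal elements) and a surjective morphism of Boolean inverse semigroups $C\to B$. For an ample Hausdorff groupoid $\mathcal G$, let $\Gamma(\mathcal G)$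 be the Boolean inverse semigroup of its compact open bisections, with product $UV=\{gh \mid g\in U,\ h\in V,\ d(g)=r(h)\}$. Let $\mathcal G_{(\mathrm T_1)}$ be the groupoid of the equivalence relation on $\mathbb N\cup\{\infty\}$ that relates all finite points to each other and relates $\infty$ only to itself, with the topology in which the unit space is an open copy of the one-point compactification $\mathbb N\cup\{\infty\}$ and every arrow between finite points is isolated. Put $B_{(\mathrm T_1)}=\Gamma(\mathcal G_{(\mathrm T_1)})$. **Proposition.** Let $\mathcal G$ be an ample Hausdorff groupoid. 1. If the orbit space of $\mathcal G$ is not $\mathrm T_1$, then $\Gamma(\mathcal G)$ has $B_{(\mathrm T_1)}$ as a subquotient. 2. If $\mathcal G$ is second countable and $\Gamma(\mathcal G)$ has $B_{(\mathrm T_1)}$ as a subquotient, then the orbit space of $\mathcal G$ is not $\mathrm T_1$. In particular, if $\mathcal G$ is second countable, the orbit space of $\mathcal G$ is not $\mathrm T_1$ if and only if $\Gamma(\mathcal G)$ has $B_{(\mathrm T_1)}$ as a subquotient. -/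

import Mathlib

open CategoryTheory Topology Set

universe u v

namespace NCStone

/-! ### Boolean inverse semigroups -/

/-- An inverse semigroup with zero: every `s` has exactly one `t` with `s t s = s` and
`t s t = t`, and this `t` is `s⁻¹` (the element often written `s^*`). -/
class InverseSemigroupWithZero (S : Type u) extends SemigroupWithZero S, Inv S where
  mul_inv_mul_self (s : S) : s * s⁻¹ * s = s
  inv_mul_inv_self (s : S) : s⁻¹ * s * s⁻¹ = s⁻¹
  eq_inv (s t : S) : s * t * s = s → t * s * t = t → t = s⁻¹

section InverseSemigroup

variable {S : Type u} [InverseSemigroupWithZero S]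

/-- The support `s^* s`. -/
def supp (s : S) : S := s⁻¹ * s

/-- The natural order: `s ≤ t` iff `supp s ≤ supp t` and `t (supp s) = s`. -/
def NatLE (s t : S) : Prop := supp s * supp t = supp s ∧ t * supp s = s

/-- Orthogonality: `s t^* = 0 = s^* t`. -/
def Orthogonal (s t : S) : Prop := s * t⁻¹ = 0 ∧ s⁻¹ * t = 0

/-- `u` is the join (least upper bound) of `s` and `t` in the natural order. -/
def IsJoin (s t u : S) : Prop :=
  NatLE s u ∧ NatLE t u ∧ ∀ w, NatLE s w → NatLE t w → NatLE u w

/-- `g` is the relative complement `f \ e` of the idempotent `e` in the idempotent `f`: the largest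
idempotent below `f` that is orthogonal to `e`. -/
def IsRelCompl (f e g : S) : Prop :=
  (g * g = g ∧ g * f = g ∧ g * e = 0) ∧ ∀ h, h * h = h → h * f = h → h * e = 0 → h * g = h

end InverseSemigroup

/-- A Boolean inverse semigroup: an inverse semigroup with zero whose semilattice of idempotents
(`e ≤ f` iff `e f = e`) is a generalized Boolean algebra, and in which orthogonal elements have
joins.  (Two orthogonal elements are enough: nonempty finite orthogonal families follow by
induction, and the empty join is `0`.) -/
class BooleanInverseSemigroup (S : Type u) extends InverseSemigroupWithZero S where
  idempotents_boolean : ∃ A : GeneralizedBooleanAlgebra {e : S // e * e = e},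
    ∀ e f, A.le e f ↔ e.1 * f.1 = e.1
  exists_join (s t : S) : Orthogonal s t → ∃ w, IsJoin s t w

/-- A morphism of Boolean inverse semigroups: a semigroup homomorphism preserving `0` (the empty
join) and joins of orthogonal elements.  It preserves inverses automatically. -/
structure IsBooleanMorphism {S : Type u} {T : Type v} [BooleanInverseSemigroup S]
    [BooleanInverseSemigroup T] (φ : S → T) : Prop where
  map_mul (s t : S) : φ (s * t) = φ s * φ t
  map_zero : φ 0 = 0
  map_join (s t w : S) : Orthogonal s t → IsJoin s t w → IsJoin (φ s) (φ t) (φ w)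

/-- A Boolean inverse subsemigroup: a subset closed under products, inverses, relative complements
of idempotents and joins of orthogonal elements, and containing `0`; equivalently, a subset that
is a Boolean inverse semigroup and whose inclusion is a morphism of such. -/
structure BooleanInverseSubsemigroup (S : Type u) [BooleanInverseSemigroup S] where
  carrier : Set S
  mul_mem {s t : S} : s ∈ carrier → t ∈ carrier → s * t ∈ carrier
  inv_mem {s : S} : s ∈ carrier → s⁻¹ ∈ carrier
  zero_mem : (0 : S) ∈ carrier
  relCompl_mem {e f g : S} : e ∈ carrier → f ∈ carrier → e * e = e → f * f = f →
    IsRelCompl f e g → g ∈ carrier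
  join_mem {s t w : S} : s ∈ carrier → t ∈ carrier → Orthogonal s t → IsJoin s t w → w ∈ carrier

section Facts

variable {S : Type u} [InverseSemigroupWithZero S]

open InverseSemigroupWithZero

theorem inv_of_idem {e : S} (he : e * e = e) : e⁻¹ = e :=
  (eq_inv e e (by rw [he, he]) (by rw [he, he])).symm

theorem inv_inv' (s : S) : s⁻¹⁻¹ = s :=
  (eq_inv s⁻¹ s (inv_mul_inv_self s) (mul_inv_mul_self s)).symm

theorem idem_mul {e f : S} (he : e * e = e) (hf : f * f = f) : (e * f) * (e * f) = e * f := by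
  have hx1 := mul_inv_mul_self (e * f)
  have hx2 := inv_mul_inv_self (e * f)
  set x := (e * f)⁻¹ with hx
  have h1 : f * x * e = x := by
    rw [hx]
    apply eq_inv
    · have : e * f * (f * x * e) * (e * f) = e * (f * f) * x * ((e * e) * f) := by
        simp only [mul_assoc]
      rw [this, he, hf]
      exact hx1
    · have : f * x * e * (e * f) * (f * x * e) = f * (x * ((e * e) * (f * f)) * x) * e := by
        simp only [mul_assoc]
      rw [this, he, hf, hx2]
  have h2 : x * x = x := by
    have : x * x = f * (x * (e * f) * x) * e := by
      conv_lhs => rw [← h1]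
      simp only [mul_assoc]
    rw [this, hx2, h1]
  have h3 : e * f = x := by
    rw [← inv_inv' (e * f), ← hx]
    exact inv_of_idem h2
  rw [h3, h2]

theorem idem_comm {e f : S} (he : e * e = e) (hf : f * f = f) : e * f = f * e := by
  have h1 := idem_mul he hf
  have h2 := idem_mul hf he
  have : f * e = (e * f)⁻¹ := by
    apply eq_inv
    · have : e * f * (f * e) * (e * f) = e * (f * f) * ((e * e) * f) := by simp only [mul_assoc]
      rw [this, he, hf, h1]
    · have : f * e * (e * f) * (f * e) = f * (e * e) * ((f * f) * e) := by simp only [mul_assoc]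
      rw [this, he, hf, h2]
  rw [this, inv_of_idem h1]

theorem supp_idem (s : S) : supp s * supp s = supp s := by
  simp only [supp, ← mul_assoc, inv_mul_inv_self]

theorem supp_of_idem {e : S} (he : e * e = e) : supp e = e := by
  rw [supp, inv_of_idem he, he]

theorem mul_supp (s : S) : s * supp s = s := by
  rw [supp, ← mul_assoc, mul_inv_mul_self]

theorem natLE_idem {e f : S} (he : e * e = e) (hf : f * f = f) : NatLE e f ↔ e * f = e := by
  rw [NatLE, supp_of_idem he, supp_of_idem hf, idem_comm hf he, and_self]

theorem NatLE.idem {s f : S} (h : NatLE s f) (hf : f * f = f) : s * s = s := by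
  rw [← h.2]
  exact idem_mul hf (supp_idem s)

theorem NatLE.antisymm {s t : S} (h : NatLE s t) (h' : NatLE t s) : s = t := by
  have : supp s = supp t := by
    rw [← h.1, idem_comm (supp_idem s) (supp_idem t), h'.1]
  rw [← h.2, this, mul_supp]

theorem IsJoin.unique {s t u w : S} (h : IsJoin s t u) (h' : IsJoin s t w) : u = w :=
  (h.2.2 w h'.1 h'.2.1).antisymm (h'.2.2 u h.1 h.2.1)

end Facts

namespace BooleanInverseSubsemigroup

variable {S : Type u} [BooleanInverseSemigroup S]

open InverseSemigroupWithZero BooleanInverseSemigroup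

/-- The operations of `S`, restricted to a Boolean inverse subsemigroup. -/
instance (C : BooleanInverseSubsemigroup S) : InverseSemigroupWithZero C.carrier where
  mul s t := ⟨s.1 * t.1, C.mul_mem s.2 t.2⟩
  mul_assoc s t w := Subtype.ext (mul_assoc s.1 t.1 w.1)
  zero := ⟨0, C.zero_mem⟩
  zero_mul s := Subtype.ext (zero_mul s.1)
  mul_zero s := Subtype.ext (mul_zero s.1)
  inv s := ⟨s.1⁻¹, C.inv_mem s.2⟩
  mul_inv_mul_self s := Subtype.ext (mul_inv_mul_self s.1)
  inv_mul_inv_self s := Subtype.ext (inv_mul_inv_self s.1)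
  eq_inv s t h h' := Subtype.ext
    (eq_inv s.1 t.1 (congrArg Subtype.val h) (congrArg Subtype.val h'))

variable (C : BooleanInverseSubsemigroup S)

theorem coe_mul (s t : C.carrier) : (s * t).1 = s.1 * t.1 := rfl

theorem coe_inv (s : C.carrier) : (s⁻¹).1 = s.1⁻¹ := rfl

theorem coe_zero : (0 : C.carrier).1 = 0 := rfl

theorem coe_supp (s : C.carrier) : (supp s).1 = supp s.1 := rfl

theorem natLE_coe (s t : C.carrier) : NatLE s t ↔ NatLE s.1 t.1 := by
  simp only [NatLE, Subtype.ext_iff, coe_mul, coe_supp]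

theorem orthogonal_coe (s t : C.carrier) : Orthogonal s t ↔ Orthogonal s.1 t.1 := by
  simp only [Orthogonal, Subtype.ext_iff, coe_mul, coe_inv, coe_zero]

/-- A Boolean inverse subsemigroup is a Boolean inverse semigroup in its own right. -/
instance : BooleanInverseSemigroup C.carrier where
  idempotents_boolean := by
    classical
    obtain ⟨A, hA⟩ := idempotents_boolean (S := S)
    let _ := A
    have hle : ∀ e f : {e : S // e * e = e}, e ≤ f ↔ e.1 * f.1 = e.1 := hA
    have hinf : ∀ e f : {e : S // e * e = e}, (e ⊓ f).1 = e.1 * f.1 := by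
      intro e f
      have h1 : (⟨e.1 * f.1, idem_mul e.2 f.2⟩ : {e : S // e * e = e}) ≤ e ⊓ f := by
        refine le_inf ((hle _ _).2 ?_) ((hle _ _).2 ?_)
        · change e.1 * f.1 * e.1 = e.1 * f.1
          rw [idem_comm e.2 f.2, mul_assoc, e.2]
        · change e.1 * f.1 * f.1 = e.1 * f.1
          rw [mul_assoc, f.2]
      have h2 : e ⊓ f ≤ (⟨e.1 * f.1, idem_mul e.2 f.2⟩ : {e : S // e * e = e}) := by
        refine (hle _ _).2 ?_
        change (e ⊓ f).1 * (e.1 * f.1) = (e ⊓ f).1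
        rw [← mul_assoc, (hle _ _).1 (inf_le_left : e ⊓ f ≤ e),
          (hle _ _).1 (inf_le_right : e ⊓ f ≤ f)]
      exact congrArg Subtype.val (le_antisymm h2 h1)
    have hbot : (⊥ : {e : S // e * e = e}).1 = 0 := by
      have : (⊥ : {e : S // e * e = e}) ≤ ⟨0, zero_mul 0⟩ := bot_le
      rw [hle] at this
      rw [← this, mul_zero]
    have hdis : ∀ e f : {e : S // e * e = e}, Disjoint e f ↔ e.1 * f.1 = 0 := by
      intro e f
      rw [disjoint_iff, Subtype.ext_iff, hinf, hbot]
    have hsdiff : ∀ e f : {e : S // e * e = e}, e.1 ∈ C.carrier → f.1 ∈ C.carrier →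
        (e \ f).1 ∈ C.carrier := by
      intro e f he hf
      refine C.relCompl_mem hf he f.2 e.2 ⟨⟨(e \ f).2, (hle _ _).1 sdiff_le, ?_⟩, ?_⟩
      · exact (hdis _ _).1 disjoint_sdiff_self_left
      · intro h h1 h2 h3
        exact (hle ⟨h, h1⟩ _).1 (le_sdiff.2 ⟨(hle ⟨h, h1⟩ _).2 h2, (hdis ⟨h, h1⟩ _).2 h3⟩)
    have hsup : ∀ e f : {e : S // e * e = e}, e.1 ∈ C.carrier → f.1 ∈ C.carrier →
        (e ⊔ f).1 ∈ C.carrier := by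
      intro e f he hf
      have h0 : (e \ f).1 * f.1 = 0 := (hdis _ _).1 disjoint_sdiff_self_left
      have hort : Orthogonal (e \ f).1 f.1 := by
        rw [Orthogonal, inv_of_idem f.2, inv_of_idem (e \ f).2]
        exact ⟨h0, h0⟩
      obtain ⟨w, hw⟩ := exists_join _ _ hort
      have hle1 : NatLE (e \ f).1 (e ⊔ f).1 :=
        (natLE_idem (e \ f).2 (e ⊔ f).2).2 ((hle _ _).1 (sdiff_le.trans le_sup_left))
      have hle2 : NatLE f.1 (e ⊔ f).1 :=
        (natLE_idem f.2 (e ⊔ f).2).2 ((hle _ _).1 le_sup_right)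
      have hwe := hw.2.2 _ hle1 hle2
      have hwi : w * w = w := hwe.idem (e ⊔ f).2
      have hb : e ⊔ f ≤ (⟨w, hwi⟩ : {e : S // e * e = e}) := by
        rw [← sdiff_sup_self]
        exact sup_le ((hle _ _).2 ((natLE_idem (e \ f).2 hwi).1 hw.1))
          ((hle _ _).2 ((natLE_idem f.2 hwi).1 hw.2.1))
      have hb' : (⟨w, hwi⟩ : {e : S // e * e = e}) ≤ e ⊔ f :=
        (hle _ _).2 ((natLE_idem hwi (e ⊔ f).2).1 hwe)
      have : w = (e ⊔ f).1 := congrArg Subtype.val (le_antisymm hb' hb)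
      rw [← this]
      exact C.join_mem (hsdiff e f he hf) hf hort hw
    let ι : {e : C.carrier // e * e = e} → {e : S // e * e = e} :=
      fun e => ⟨e.1.1, congrArg Subtype.val e.2⟩
    have hι : Function.Injective ι := by
      intro e f h
      have h' : (ι e).1 = (ι f).1 := congrArg Subtype.val h
      exact Subtype.ext (Subtype.ext h')
    let _ : Max {e : C.carrier // e * e = e} :=
      ⟨fun e f => ⟨⟨(ι e ⊔ ι f).1, hsup _ _ e.1.2 f.1.2⟩, Subtype.ext (ι e ⊔ ι f).2⟩⟩
    let _ : Min {e : C.carrier // e * e = e} := ⟨fun e f => ⟨e.1 * f.1, idem_mul e.2 f.2⟩⟩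
    let _ : LE {e : C.carrier // e * e = e} := ⟨fun e f => ι e ≤ ι f⟩
    let _ : LT {e : C.carrier // e * e = e} := ⟨fun e f => ι e < ι f⟩
    let _ : Bot {e : C.carrier // e * e = e} := ⟨⟨0, zero_mul 0⟩⟩
    let _ : SDiff {e : C.carrier // e * e = e} :=
      ⟨fun e f => ⟨⟨(ι e \ ι f).1, hsdiff _ _ e.1.2 f.1.2⟩, Subtype.ext (ι e \ ι f).2⟩⟩
    refine ⟨hι.generalizedBooleanAlgebra ι Iff.rfl Iff.rfl (fun _ _ => rfl)
      (fun e f => Subtype.ext (hinf (ι e) (ι f)).symm) (Subtype.ext hbot.symm) (fun _ _ => rfl), ?_⟩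
    intro e f
    exact (hle (ι e) (ι f)).trans (Subtype.ext_iff (a1 := e.1 * f.1) (a2 := e.1)).symm
  exists_join s t h := by
    rw [orthogonal_coe] at h
    obtain ⟨w, hw⟩ := exists_join _ _ h
    refine ⟨⟨w, C.join_mem s.2 t.2 h hw⟩, ?_, ?_, ?_⟩
    · exact (C.natLE_coe _ _).2 hw.1
    · exact (C.natLE_coe _ _).2 hw.2.1
    · intro x hx hx'
      exact (C.natLE_coe _ _).2 (hw.2.2 x.1 ((C.natLE_coe _ _).1 hx) ((C.natLE_coe _ _).1 hx'))

end BooleanInverseSubsemigroup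

/-- `S` has `B` as a subquotient: some Boolean inverse subsemigroup of `S` admits a surjective
morphism of Boolean inverse semigroups onto `B`. -/
def HasSubquotient (S : Type u) (B : Type v) [BooleanInverseSemigroup S]
    [BooleanInverseSemigroup B] : Prop :=
  ∃ (C : BooleanInverseSubsemigroup S) (π : C.carrier → B),
    IsBooleanMorphism π ∧ Function.Surjective π

/-! ### Topological groupoids

A groupoid is a category `X` (the type of units) in which every arrow is invertible; its set of
arrows is `Quiver.Total X`.  An arrow `g : x ⟶ y` has source `d(g) = g.left = x` and range
`r(g) = g.right = y`, and the product `g h` is defined when `d(g) = r(h)`. -/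

section Groupoids

variable {X : Type u} [Groupoid.{v} X]

/-- The unit at `x`. -/
def unitArr (x : X) : Quiver.Total X := ⟨x, x, 𝟙 x⟩

/-- The inverse arrow. -/
def invArr (g : Quiver.Total X) : Quiver.Total X := ⟨g.right, g.left, Groupoid.inv g.hom⟩

/-- The product `g h` of arrows with `d(g) = r(h)`. -/
def mulArr (g h : Quiver.Total X) (w : h.right = g.left) : Quiver.Total X :=
  ⟨h.left, g.right, h.hom ≫ eqToHom w ≫ g.hom⟩

/-- A topological groupoid: all structure maps are continuous.  (As `d ∘ unitArr = id`, the topology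
on `X` is the one induced from the space of arrows along `unitArr`.) -/
class IsTopologicalGroupoid (X : Type u) [Groupoid.{v} X] [TopologicalSpace X]
    [TopologicalSpace (Quiver.Total X)] : Prop where
  continuous_source : Continuous (Quiver.Total.left : Quiver.Total X → X)
  continuous_range : Continuous (Quiver.Total.right : Quiver.Total X → X)
  continuous_unit : Continuous (unitArr : X → Quiver.Total X)
  continuous_inv : Continuous (invArr : Quiver.Total X → Quiver.Total X)
  continuous_mul : Continuous
    (fun p : {p : Quiver.Total X × Quiver.Total X // p.2.right = p.1.left} =>
      mulArr p.1.1 p.1.2 p.2)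

/-- A bisection: a set of arrows on which both `d` and `r` are homeomorphisms onto their images. -/
def IsBisection [TopologicalSpace X] [TopologicalSpace (Quiver.Total X)]
    (U : Set (Quiver.Total X)) : Prop :=
  IsEmbedding (fun g : U => g.1.left) ∧ IsEmbedding (fun g : U => g.1.right)

/-- An étale groupoid: a topological groupoid whose source map is a local homeomorphism. -/
class IsEtaleGroupoid (X : Type u) [Groupoid.{v} X] [TopologicalSpace X]
    [TopologicalSpace (Quiver.Total X)] : Prop extends IsTopologicalGroupoid X where
  etale : IsLocalHomeomorph (Quiver.Total.left : Quiver.Total X → X)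

/-- An ample groupoid: an étale groupoid whose topology has a basis consisting of compact open
bisections. -/
class IsAmpleGroupoid (X : Type u) [Groupoid.{v} X] [TopologicalSpace X]
    [TopologicalSpace (Quiver.Total X)] : Prop extends IsEtaleGroupoid X where
  basis : TopologicalSpace.IsTopologicalBasis
    {U : Set (Quiver.Total X) | IsCompact U ∧ IsOpen U ∧ IsBisection U}

/-- The orbit space: the quotient of the unit space that identifies `x` and `y` when there is an
arrow from `x` to `y` (every arrow being an isomorphism), with the quotient topology. -/
abbrev OrbitSpace (X : Type u) [Groupoid.{v} X] : Type u := Quotient (isIsomorphicSetoid X)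

/-- The compact open bisections of a groupoid, `Γ(G)`. -/
@[ext]
structure BisectionSemigroup (X : Type u) [Groupoid.{v} X] [TopologicalSpace X]
    [TopologicalSpace (Quiver.Total X)] : Type (max u v) where
  carrier : Set (Quiver.Total X)
  isCompact : IsCompact carrier
  isOpen : IsOpen carrier
  isBisection : IsBisection carrier

/-- The product of two sets of arrows. -/
def mulSet (U V : Set (Quiver.Total X)) : Set (Quiver.Total X) :=
  {k | ∃ g ∈ U, ∃ h ∈ V, ∃ w : h.right = g.left, k = mulArr g h w}

/-- The set of inverses of a set of arrows. -/
def invSet (U : Set (Quiver.Total X)) : Set (Quiver.Total X) := {k | invArr k ∈ U}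

theorem mulArr_assoc (g h k : Quiver.Total X) (w : h.right = g.left) (w' : k.right = h.left) :
    mulArr (mulArr g h w) k w' = mulArr g (mulArr h k w') w := by
  obtain ⟨a, b, g⟩ := g
  obtain ⟨c, d, h⟩ := h
  obtain ⟨e, f, k⟩ := k
  obtain rfl : d = a := w
  obtain rfl : f = c := w'
  simp [mulArr]

theorem invArr_invArr (g : Quiver.Total X) : invArr (invArr g) = g := by
  simp [invArr]

theorem mulArr_invArr_cancel (k h : Quiver.Total X) (w : h.left = k.left) :
    mulArr (mulArr k (invArr h) w) h rfl = k := by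
  obtain ⟨a, b, g⟩ := k
  obtain ⟨c, d, h⟩ := h
  obtain rfl : c = a := w
  simp [mulArr, invArr]

theorem mulArr_cancel_invArr (g h : Quiver.Total X) (w : h.right = g.left) :
    mulArr (mulArr g h w) (invArr h) rfl = g := by
  obtain ⟨a, b, g⟩ := g
  obtain ⟨c, d, h⟩ := h
  obtain rfl : d = a := w
  simp [mulArr, invArr]

theorem mulArr_inv_self (g : Quiver.Total X) : mulArr (mulArr g (invArr g) rfl) g rfl = g := by
  simp [mulArr, invArr]

theorem mulArr_unitArr (g : Quiver.Total X) (x : X) (w : x = g.left) :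
    mulArr g (unitArr x) w = g := by
  subst w
  simp [mulArr, unitArr]

theorem eq_invArr_of_mulArr (l h : Quiver.Total X) (w : h.right = l.left)
    (w' : l.right = h.left) (e : l = mulArr (mulArr l h w) l w') : h = invArr l := by
  obtain ⟨a, b, l⟩ := l
  obtain ⟨c, d, h⟩ := h
  obtain rfl : d = a := w
  obtain rfl : b = c := w'
  simp only [mulArr, eqToHom_refl, Category.id_comp, Quiver.Total.mk.injEq, heq_eq_eq,
    true_and] at e
  have e1 : h = Groupoid.inv l := by
    rw [← cancel_mono l, Groupoid.inv_comp, ← cancel_epi l]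
    simpa using e.symm
  rw [e1, invArr]

theorem invArr_mulArr (g h : Quiver.Total X) (w : h.right = g.left) :
    invArr (mulArr g h w) = mulArr (invArr h) (invArr g) w.symm := by
  obtain ⟨a, b, g⟩ := g
  obtain ⟨c, d, h⟩ := h
  obtain rfl : d = a := w
  simp [mulArr, invArr]

theorem mulSet_assoc (U V W : Set (Quiver.Total X)) :
    mulSet (mulSet U V) W = mulSet U (mulSet V W) := by
  ext x
  constructor
  · rintro ⟨_, ⟨g, hg, h, hh, w, rfl⟩, k, hk, w', rfl⟩
    exact ⟨g, hg, _, ⟨h, hh, k, hk, w', rfl⟩, w, mulArr_assoc g h k w w'⟩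
  · rintro ⟨g, hg, _, ⟨h, hh, k, hk, w', rfl⟩, w, rfl⟩
    exact ⟨_, ⟨g, hg, h, hh, w, rfl⟩, k, hk, w', (mulArr_assoc g h k w w').symm⟩

theorem invSet_eq_image (U : Set (Quiver.Total X)) : invSet U = invArr '' U := by
  ext k
  exact ⟨fun h => ⟨_, h, invArr_invArr k⟩, by
    rintro ⟨g, hg, rfl⟩
    change invArr (invArr g) ∈ U
    rwa [invArr_invArr]⟩

theorem invSet_invSet (U : Set (Quiver.Total X)) : invSet (invSet U) = U := by
  ext k
  change invArr (invArr k) ∈ U ↔ k ∈ U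
  rw [invArr_invArr]

theorem invSet_mulSet (U V : Set (Quiver.Total X)) :
    invSet (mulSet U V) = mulSet (invSet V) (invSet U) := by
  ext x
  constructor
  · rintro ⟨g, hg, h, hh, w, hx⟩
    refine ⟨invArr h, ?_, invArr g, ?_, w.symm, ?_⟩
    · change invArr (invArr h) ∈ V
      rwa [invArr_invArr]
    · change invArr (invArr g) ∈ U
      rwa [invArr_invArr]
    · rw [← invArr_mulArr g h w, ← hx, invArr_invArr]
  · rintro ⟨g, hg, h, hh, w, rfl⟩
    exact ⟨invArr h, hh, invArr g, hg, w.symm, invArr_mulArr _ _ _⟩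

section Ample

variable [TopologicalSpace X] [TopologicalSpace (Quiver.Total X)]

open IsTopologicalGroupoid IsEtaleGroupoid

theorem isLocalHomeomorph_range [IsEtaleGroupoid X] :
    IsLocalHomeomorph (Quiver.Total.right : Quiver.Total X → X) := by
  let φ : Quiver.Total X ≃ₜ Quiver.Total X :=
    ⟨⟨invArr, invArr, invArr_invArr, invArr_invArr⟩, continuous_inv, continuous_inv⟩
  exact etale.comp φ.isLocalHomeomorph

theorem isBisection_iff [IsEtaleGroupoid X] {U : Set (Quiver.Total X)} (hU : IsOpen U) :
    IsBisection U ↔ InjOn Quiver.Total.left U ∧ InjOn Quiver.Total.right U := by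
  constructor
  · rintro ⟨h1, h2⟩
    exact ⟨injOn_iff_injective.2 h1.injective, injOn_iff_injective.2 h2.injective⟩
  · rintro ⟨h1, h2⟩
    exact ⟨((etale (X := X)).comp hU.isOpenEmbedding_subtypeVal.isLocalHomeomorph
        |>.isOpenEmbedding_of_injective (injOn_iff_injective.1 h1)).isEmbedding,
      ((isLocalHomeomorph_range (X := X)).comp hU.isOpenEmbedding_subtypeVal.isLocalHomeomorph
        |>.isOpenEmbedding_of_injective (injOn_iff_injective.1 h2)).isEmbedding⟩

theorem IsBisection.eq_of_left {U : Set (Quiver.Total X)} (hU : IsBisection U)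
    {g h : Quiver.Total X} (hg : g ∈ U) (hh : h ∈ U) (e : g.left = h.left) : g = h :=
  congrArg Subtype.val (@hU.1.injective ⟨g, hg⟩ ⟨h, hh⟩ e)

theorem IsBisection.eq_of_right {U : Set (Quiver.Total X)} (hU : IsBisection U)
    {g h : Quiver.Total X} (hg : g ∈ U) (hh : h ∈ U) (e : g.right = h.right) : g = h :=
  congrArg Subtype.val (@hU.2.injective ⟨g, hg⟩ ⟨h, hh⟩ e)

theorem isBisection_of_units [IsEtaleGroupoid X] {U : Set (Quiver.Total X)} (hU : IsOpen U)
    (h : ∀ g ∈ U, g = unitArr g.left) : IsBisection U := by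
  rw [isBisection_iff hU]
  constructor
  · intro g hg k hk e
    rw [h g hg, h k hk, e]
  · intro g hg k hk e
    rw [h g hg, h k hk] at e ⊢
    exact congrArg unitArr e

theorem isOpen_mulSet [IsEtaleGroupoid X] {U V : Set (Quiver.Total X)} (hU : IsOpen U)
    (hV : IsOpen V) : IsOpen (mulSet U V) := by
  rw [isOpen_iff_mem_nhds]
  rintro _ ⟨g, hg, h, hh, w, rfl⟩
  let P := {p : Quiver.Total X × Quiver.Total X // p.2.left = p.1.left}
  let m : P → Quiver.Total X := fun p => mulArr p.1.1 (invArr p.1.2) p.2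
  have hinv := IsTopologicalGroupoid.continuous_inv (X := X)
  let q : P → {p : Quiver.Total X × Quiver.Total X // p.2.right = p.1.left} :=
    fun p => ⟨(p.1.1, invArr p.1.2), p.2⟩
  have hq : Continuous q := Continuous.subtype_mk (by fun_prop) _
  have hm : Continuous m := IsTopologicalGroupoid.continuous_mul.comp hq
  have hopen := hU.preimage hm
  obtain ⟨O, hO, hO'⟩ := isOpen_induced_iff.1 hopen
  have hmem : (mulArr g h w, h) ∈ O := by
    have : (⟨(mulArr g h w, h), rfl⟩ : P) ∈ Subtype.val ⁻¹' O := by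
      rw [hO']
      change mulArr (mulArr g h w) (invArr h) rfl ∈ U
      rwa [mulArr_cancel_invArr]
    exact this
  obtain ⟨A, B, hA, hB, hkA, hhB, hAB⟩ := isOpen_prod_iff.1 hO _ _ hmem
  have hD : IsOpen (Quiver.Total.left '' (B ∩ V)) := etale.isOpenMap _ (hB.inter hV)
  have hN : IsOpen (A ∩ Quiver.Total.left ⁻¹' (Quiver.Total.left '' (B ∩ V))) :=
    hA.inter (hD.preimage continuous_source)
  refine Filter.mem_of_superset (hN.mem_nhds ⟨hkA, h, ⟨hhB, hh⟩, rfl⟩) ?_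
  rintro k ⟨hk, l, ⟨hlB, hlV⟩, hlk⟩
  have : (⟨(k, l), hlk⟩ : P) ∈ m ⁻¹' U := by
    rw [← hO']
    exact hAB ⟨hk, hlB⟩
  exact ⟨_, this, l, hlV, rfl, (mulArr_invArr_cancel k l hlk).symm⟩

theorem t2_units [IsTopologicalGroupoid X] [T2Space (Quiver.Total X)] : T2Space X :=
  .of_injective_continuous (f := unitArr)
    (fun _ _ h => congrArg Quiver.Total.left h) continuous_unit

theorem isCompact_mulSet [IsTopologicalGroupoid X] [T2Space (Quiver.Total X)]
    {U V : Set (Quiver.Total X)} (hU : IsCompact U) (hV : IsCompact V) :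
    IsCompact (mulSet U V) := by
  have := t2_units (X := X)
  have hc : IsClosed {p : Quiver.Total X × Quiver.Total X | p.2.right = p.1.left} :=
    isClosed_eq (continuous_range.comp continuous_snd) (continuous_source.comp continuous_fst)
  have hK : IsCompact (Subtype.val ⁻¹' (U ×ˢ V) :
      Set {p : Quiver.Total X × Quiver.Total X // p.2.right = p.1.left}) :=
    hc.isClosedEmbedding_subtypeVal.isCompact_preimage (hU.prod hV)
  convert hK.image continuous_mul using 1
  ext k
  constructor
  · rintro ⟨g, hg, h, hh, w, rfl⟩
    exact ⟨⟨(g, h), w⟩, ⟨hg, hh⟩, rfl⟩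
  · rintro ⟨⟨⟨g, h⟩, w⟩, ⟨hg, hh⟩, rfl⟩
    exact ⟨g, hg, h, hh, w, rfl⟩

theorem IsBisection.invSet [IsEtaleGroupoid X] {U : Set (Quiver.Total X)} (hU : IsBisection U)
    (ho : IsOpen U) : IsBisection (NCStone.invSet U) := by
  rw [isBisection_iff (U := NCStone.invSet U)
    (ho.preimage IsTopologicalGroupoid.continuous_inv)]
  constructor
  · intro g hg h hh e
    rw [← invArr_invArr g, hU.eq_of_right hg hh e, invArr_invArr]
  · intro g hg h hh e
    rw [← invArr_invArr g, hU.eq_of_left hg hh e, invArr_invArr]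

theorem mem_mulSet_mulSet_iff {U T : Set (Quiver.Total X)} (hU : IsBisection U)
    {k : Quiver.Total X} (hk : k ∈ U) : k ∈ mulSet (mulSet U T) U ↔ invArr k ∈ T := by
  constructor
  · rintro ⟨_, ⟨g, hg, h, hh, w, rfl⟩, l, hl, w', e⟩
    obtain rfl : g = k := hU.eq_of_right hg hk (congrArg Quiver.Total.right e).symm
    obtain rfl : l = g := hU.eq_of_left hl hg (congrArg Quiver.Total.left e).symm
    have : h = invArr l := eq_invArr_of_mulArr l h w w' e
    rwa [← this]
  · intro hT
    exact ⟨_, ⟨k, hk, _, hT, rfl, rfl⟩, k, hk, rfl, (mulArr_inv_self k).symm⟩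

theorem mulSet_invSet_mulSet {U : Set (Quiver.Total X)} (hU : IsBisection U) :
    mulSet (mulSet U (invSet U)) U = U := by
  ext k
  constructor
  · rintro ⟨_, ⟨g, hg, h, hh, w, rfl⟩, l, hl, w', rfl⟩
    have e : invArr h = g := hU.eq_of_left hh hg w
    have e' : invArr h = l := hU.eq_of_right hh hl w'.symm
    subst e
    subst e'
    have : mulArr (mulArr (invArr h) h w) (invArr h) w' = invArr h := mulArr_cancel_invArr _ _ _
    rwa [this]
  · intro hk
    refine (mem_mulSet_mulSet_iff hU hk).2 ?_
    change invArr (invArr k) ∈ U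
    rwa [invArr_invArr]

namespace BisectionSemigroup

variable [IsAmpleGroupoid X] [T2Space (Quiver.Total X)]

/-- The inverse semigroup structure of `Γ(G)`: product and inverse of sets, with zero `∅`. -/
instance : InverseSemigroupWithZero (BisectionSemigroup X) where
  mul U V := ⟨mulSet U.carrier V.carrier, isCompact_mulSet U.isCompact V.isCompact,
    isOpen_mulSet U.isOpen V.isOpen, by
      rw [isBisection_iff (isOpen_mulSet U.isOpen V.isOpen)]
      constructor
      · rintro _ ⟨g, hg, h, hh, w, rfl⟩ _ ⟨g', hg', h', hh', w', rfl⟩ e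
        obtain rfl := V.isBisection.eq_of_left hh hh' e
        obtain rfl := U.isBisection.eq_of_left hg hg' (w.symm.trans w')
        rfl
      · rintro _ ⟨g, hg, h, hh, w, rfl⟩ _ ⟨g', hg', h', hh', w', rfl⟩ e
        obtain rfl := U.isBisection.eq_of_right hg hg' e
        obtain rfl := V.isBisection.eq_of_right hh hh' (w.trans w'.symm)
        rfl⟩
  mul_assoc U V W := BisectionSemigroup.ext (mulSet_assoc U.carrier V.carrier W.carrier)
  zero := ⟨∅, isCompact_empty, isOpen_empty, by
    rw [isBisection_iff isOpen_empty]
    exact ⟨injOn_empty _, injOn_empty _⟩⟩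
  zero_mul U := BisectionSemigroup.ext (eq_empty_of_forall_notMem fun _ ⟨_, hg, _⟩ => hg)
  mul_zero U := BisectionSemigroup.ext (eq_empty_of_forall_notMem fun _ ⟨_, _, _, hh, _⟩ => hh)
  inv U := ⟨invSet U.carrier, by
      rw [invSet_eq_image]
      exact U.isCompact.image IsTopologicalGroupoid.continuous_inv,
    U.isOpen.preimage IsTopologicalGroupoid.continuous_inv, U.isBisection.invSet U.isOpen⟩
  mul_inv_mul_self U := BisectionSemigroup.ext (mulSet_invSet_mulSet U.isBisection)
  inv_mul_inv_self U := by
    have := mulSet_invSet_mulSet (U.isBisection.invSet U.isOpen)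
    rw [invSet_invSet] at this
    exact BisectionSemigroup.ext this
  eq_inv U T h h' := by
    have h1 : mulSet (mulSet U.carrier T.carrier) U.carrier = U.carrier :=
      congrArg BisectionSemigroup.carrier h
    have h2 : mulSet (mulSet T.carrier U.carrier) T.carrier = T.carrier :=
      congrArg BisectionSemigroup.carrier h'
    apply BisectionSemigroup.ext
    ext k
    constructor
    · intro hk
      exact (mem_mulSet_mulSet_iff T.isBisection hk).1 (by rwa [h2])
    · intro hk
      have hk' : invArr k ∈ U.carrier := hk
      have := (mem_mulSet_mulSet_iff U.isBisection hk').1 (by rwa [h1])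
      rwa [invArr_invArr] at this

theorem carrier_mul (U V : BisectionSemigroup X) :
    (U * V).carrier = mulSet U.carrier V.carrier := rfl

theorem carrier_inv (U : BisectionSemigroup X) : (U⁻¹).carrier = invSet U.carrier := rfl

theorem carrier_zero : (0 : BisectionSemigroup X).carrier = ∅ := rfl

theorem carrier_supp (U : BisectionSemigroup X) :
    (supp U).carrier = (fun g => unitArr g.left) '' U.carrier := by
  rw [supp, carrier_mul, carrier_inv]
  ext k
  constructor
  · rintro ⟨g, hg, h, hh, w, rfl⟩
    obtain rfl : invArr g = h := U.isBisection.eq_of_right hg hh w.symm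
    refine ⟨_, hh, ?_⟩
    simp [mulArr, invArr, unitArr]
  · rintro ⟨g, hg, rfl⟩
    refine ⟨invArr g, ?_, g, hg, rfl, ?_⟩
    · change invArr (invArr g) ∈ U.carrier
      rwa [invArr_invArr]
    · simp [mulArr, invArr, unitArr]

theorem natLE_iff (U V : BisectionSemigroup X) : NatLE U V ↔ U.carrier ⊆ V.carrier := by
  constructor
  · rintro ⟨-, h⟩
    rw [← h, carrier_mul, carrier_supp]
    rintro _ ⟨g, hg, _, ⟨l, hl, rfl⟩, w, rfl⟩
    rwa [mulArr_unitArr g l.left w]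
  · intro h
    constructor
    · apply BisectionSemigroup.ext
      ext k
      rw [carrier_mul, carrier_supp, carrier_supp]
      constructor
      · rintro ⟨_, ⟨g, hg, rfl⟩, _, ⟨l, hl, rfl⟩, w, rfl⟩
        have w' : l.left = g.left := w
        refine ⟨g, hg, ?_⟩
        simp only [w']
        exact (mulArr_unitArr (unitArr g.left) g.left rfl).symm
      · rintro ⟨g, hg, rfl⟩
        exact ⟨_, ⟨g, hg, rfl⟩, _, ⟨g, h hg, rfl⟩, rfl,
          (mulArr_unitArr (unitArr g.left) g.left rfl).symm⟩
    · apply BisectionSemigroup.ext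
      ext k
      rw [carrier_mul, carrier_supp]
      constructor
      · rintro ⟨g, hg, _, ⟨l, hl, rfl⟩, w, rfl⟩
        rw [mulArr_unitArr g l.left w]
        rwa [← V.isBisection.eq_of_left (h hl) hg w]
      · intro hk
        exact ⟨k, h hk, _, ⟨k, hk, rfl⟩, rfl, (mulArr_unitArr k k.left rfl).symm⟩

theorem mem_of_idem {U : BisectionSemigroup X} (hU : U * U = U) {g : Quiver.Total X}
    (hg : g ∈ U.carrier) : g = unitArr g.left := by
  rw [← supp_of_idem hU, carrier_supp] at hg
  obtain ⟨l, hl, rfl⟩ := hg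
  rfl

theorem idem_of_units {U : BisectionSemigroup X} (h : ∀ g ∈ U.carrier, g = unitArr g.left) :
    U * U = U := by
  have : supp U = U := by
    apply BisectionSemigroup.ext
    rw [carrier_supp]
    ext k
    constructor
    · rintro ⟨g, hg, rfl⟩
      change unitArr g.left ∈ U.carrier
      rwa [← h g hg]
    · intro hk
      exact ⟨k, hk, (h k hk).symm⟩
  rw [← this, supp_idem]

/-- A compact open set of units, as an idempotent of `Γ(G)`. -/
def ofUnits (U : Set (Quiver.Total X)) (hc : IsCompact U) (ho : IsOpen U)
    (h : ∀ g ∈ U, g = unitArr g.left) : {e : BisectionSemigroup X // e * e = e} :=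
  ⟨⟨U, hc, ho, isBisection_of_units ho h⟩, idem_of_units h⟩

/-- `Γ(G)` is a Boolean inverse semigroup. -/
instance : BooleanInverseSemigroup (BisectionSemigroup X) where
  idempotents_boolean := by
    let ι : {e : BisectionSemigroup X // e * e = e} → Set (Quiver.Total X) := fun e => e.1.carrier
    have hι : Function.Injective ι := fun e f h => Subtype.ext (BisectionSemigroup.ext h)
    let _ : Max {e : BisectionSemigroup X // e * e = e} := ⟨fun e f =>
      ofUnits (ι e ∪ ι f) (e.1.isCompact.union f.1.isCompact) (e.1.isOpen.union f.1.isOpen)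
        (fun _ hg => hg.elim (mem_of_idem e.2) (mem_of_idem f.2))⟩
    let _ : Min {e : BisectionSemigroup X // e * e = e} := ⟨fun e f =>
      ofUnits (ι e ∩ ι f) (e.1.isCompact.inter f.1.isCompact) (e.1.isOpen.inter f.1.isOpen)
        (fun _ hg => mem_of_idem e.2 hg.1)⟩
    let _ : SDiff {e : BisectionSemigroup X // e * e = e} := ⟨fun e f =>
      ofUnits (ι e \ ι f) (e.1.isCompact.diff f.1.isOpen)
        (e.1.isOpen.sdiff f.1.isCompact.isClosed) (fun _ hg => mem_of_idem e.2 hg.1)⟩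
    let _ : Bot {e : BisectionSemigroup X // e * e = e} := ⟨⟨0, zero_mul 0⟩⟩
    let _ : LE {e : BisectionSemigroup X // e * e = e} := ⟨fun e f => ι e ⊆ ι f⟩
    let _ : LT {e : BisectionSemigroup X // e * e = e} := ⟨fun e f => ι e ⊂ ι f⟩
    refine ⟨hι.generalizedBooleanAlgebra ι Iff.rfl Iff.rfl (fun _ _ => rfl) (fun _ _ => rfl) rfl
      (fun _ _ => rfl), fun e f => ?_⟩
    exact (natLE_iff e.1 f.1).symm.trans (natLE_idem e.2 f.2)
  exists_join U V h := by
    have ho := U.isOpen.union V.isOpen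
    have h1 : ∀ g ∈ U.carrier, ∀ k ∈ V.carrier, g.left ≠ k.left := by
      intro g hg k hk e
      have hk' : invArr k ∈ (V⁻¹).carrier := by
        change invArr (invArr k) ∈ V.carrier
        rwa [invArr_invArr]
      have : mulArr g (invArr k) e.symm ∈ (U * V⁻¹).carrier := ⟨g, hg, _, hk', _, rfl⟩
      rw [h.1] at this
      exact this
    have h2 : ∀ g ∈ U.carrier, ∀ k ∈ V.carrier, g.right ≠ k.right := by
      intro g hg k hk e
      have hg' : invArr g ∈ (U⁻¹).carrier := by
        change invArr (invArr g) ∈ U.carrier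
        rwa [invArr_invArr]
      have : mulArr (invArr g) k e.symm ∈ (U⁻¹ * V).carrier := ⟨_, hg', k, hk, _, rfl⟩
      rw [h.2] at this
      exact this
    refine ⟨⟨U.carrier ∪ V.carrier, U.isCompact.union V.isCompact, ho,
      (isBisection_iff ho).2 ⟨?_, ?_⟩⟩, ?_, ?_, ?_⟩
    · rintro g (hg | hg) k (hk | hk) e
      · exact U.isBisection.eq_of_left hg hk e
      · exact (h1 g hg k hk e).elim
      · exact (h1 k hk g hg e.symm).elim
      · exact V.isBisection.eq_of_left hg hk e
    · rintro g (hg | hg) k (hk | hk) e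
      · exact U.isBisection.eq_of_right hg hk e
      · exact (h2 g hg k hk e).elim
      · exact (h2 k hk g hg e.symm).elim
      · exact V.isBisection.eq_of_right hg hk e
    · exact (natLE_iff _ _).2 subset_union_left
    · exact (natLE_iff _ _).2 subset_union_right
    · intro W hU hV
      exact (natLE_iff _ _).2 (union_subset ((natLE_iff _ _).1 hU) ((natLE_iff _ _).1 hV))

end BisectionSemigroup

end Ample

end Groupoids

/-! ### The groupoid `G_(T1)` and its Boolean inverse semigroup `B_(T1)` -/

/-- The unit space `ℕ ∪ {∞}` of `G_(T1)`: the one-point compactification of `ℕ`. -/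
def TOneUnits : Type := OnePoint ℕ

namespace TOneUnits

instance : TopologicalSpace TOneUnits := inferInstanceAs (TopologicalSpace (OnePoint ℕ))

instance : T2Space TOneUnits := inferInstanceAs (T2Space (OnePoint ℕ))

instance : CompactSpace TOneUnits := inferInstanceAs (CompactSpace (OnePoint ℕ))

/-- The equivalence relation on `ℕ ∪ {∞}` relating all finite points to each other. -/
def Rel (x y : TOneUnits) : Prop := x = y ∨ (x ≠ OnePoint.infty ∧ y ≠ OnePoint.infty)

theorem Rel.refl (x : TOneUnits) : Rel x x := Or.inl rfl

theorem Rel.symm {x y : TOneUnits} (h : Rel x y) : Rel y x :=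
  h.imp Eq.symm And.symm

theorem Rel.trans {x y z : TOneUnits} (h : Rel x y) (h' : Rel y z) : Rel x z := by
  rcases h with rfl | ⟨h1, h2⟩
  · exact h'
  · rcases h' with rfl | ⟨h3, h4⟩
    · exact Or.inr ⟨h1, h2⟩
    · exact Or.inr ⟨h1, h4⟩

/-- The groupoid of the equivalence relation: one arrow `x ⟶ y` when `x` and `y` are related, and
none otherwise. -/
instance : Groupoid.{0} TOneUnits where
  Hom x y := PLift (Rel x y)
  id x := ⟨Rel.refl x⟩
  comp f g := ⟨f.down.trans g.down⟩
  inv f := ⟨f.down.symm⟩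
  id_comp _ := rfl
  comp_id _ := rfl
  assoc _ _ _ := rfl
  inv_comp _ := rfl
  comp_inv _ := rfl

/-- The étale topology on the arrows of `G_(T1)`: a set is open iff the units in it form an open
subset of `ℕ ∪ {∞}`.  Thus the unit space is an open copy of `ℕ ∪ {∞}`, and all the arrows between
finite points are isolated. -/
instance : TopologicalSpace (Quiver.Total TOneUnits) := TopologicalSpace.coinduced unitArr inferInstance

theorem isOpen_arrows {W : Set (Quiver.Total TOneUnits)} :
    IsOpen W ↔ IsOpen (unitArr ⁻¹' W) := Iff.rfl

theorem arr_ext {g h : Quiver.Total TOneUnits} (e : g.left = h.left) (e' : g.right = h.right) :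
    g = h := by
  obtain ⟨a, b, g⟩ := g
  obtain ⟨c, d, h⟩ := h
  obtain rfl : a = c := e
  obtain rfl : b = d := e'
  obtain rfl : g = h := Subsingleton.elim (α := PLift (Rel a b)) g h
  rfl

theorem isOpen_singleton_unit {x : TOneUnits} (hx : x ≠ OnePoint.infty) : IsOpen {x} := by
  induction x using OnePoint.rec with
  | infty => exact (hx rfl).elim
  | coe n =>
    have : IsOpen (((↑) : ℕ → OnePoint ℕ) '' {n}) := OnePoint.isOpen_image_coe.2 (isOpen_discrete _)
    rwa [image_singleton] at this

theorem isOpen_range_unitArr : IsOpen (range (unitArr : TOneUnits → Quiver.Total TOneUnits)) := by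
  rw [isOpen_arrows, preimage_range]
  exact isOpen_univ

theorem isOpen_singleton {g : Quiver.Total TOneUnits} (hg : g.left ≠ OnePoint.infty) :
    IsOpen {g} := by
  rw [isOpen_arrows]
  by_cases h : g.left = g.right
  · convert isOpen_singleton_unit hg
    ext x
    constructor
    · intro hx
      exact congrArg Quiver.Total.left (show unitArr x = g from hx)
    · intro hx
      have hx : x = g.left := hx
      exact arr_ext hx (hx.trans h)
  · convert isOpen_empty
    refine eq_empty_of_forall_notMem fun x hx => h ?_
    have hx : unitArr x = g := hx
    rw [← hx]
    rfl

theorem eq_unitArr {g : Quiver.Total TOneUnits} (hg : g.left = OnePoint.infty) :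
    g = unitArr g.left := by
  rcases g.hom.down with h | h
  · exact arr_ext rfl h.symm
  · exact (h.1 hg).elim

theorem isOpenEmbedding_unitArr :
    IsOpenEmbedding (unitArr : TOneUnits → Quiver.Total TOneUnits) := by
  refine .of_continuous_injective_isOpenMap continuous_coinduced_rng
    (fun _ _ h => congrArg Quiver.Total.left h) fun W hW => ?_
  rw [isOpen_arrows, preimage_image_eq _ fun _ _ h => congrArg Quiver.Total.left h]
  exact hW

theorem continuous_left : Continuous (Quiver.Total.left : Quiver.Total TOneUnits → TOneUnits) :=
  continuous_coinduced_dom.2 continuous_id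

theorem continuous_right : Continuous (Quiver.Total.right : Quiver.Total TOneUnits → TOneUnits) :=
  continuous_coinduced_dom.2 continuous_id

instance : IsTopologicalGroupoid TOneUnits where
  continuous_source := continuous_left
  continuous_range := continuous_right
  continuous_unit := continuous_coinduced_rng
  continuous_inv := continuous_coinduced_dom.2 (by
    have : invArr ∘ unitArr = (unitArr : TOneUnits → Quiver.Total TOneUnits) :=
      funext fun x => arr_ext rfl rfl
    rw [this]
    exact continuous_coinduced_rng)
  continuous_mul := by
    rw [continuous_iff_continuousAt]
    rintro ⟨⟨g, h⟩, w⟩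
    by_cases hh : h.left = OnePoint.infty
    · have hmem : ∀ᶠ p in 𝓝 (⟨(g, h), w⟩ : {p : Quiver.Total TOneUnits × Quiver.Total TOneUnits //
          p.2.right = p.1.left}), p.1.2 ∈ range (unitArr : TOneUnits → Quiver.Total TOneUnits) :=
        (isOpen_range_unitArr.preimage (continuous_snd.comp continuous_subtype_val)).mem_nhds
          ⟨h.left, (eq_unitArr hh).symm⟩
      refine ContinuousAt.congr (f := fun p => p.1.1)
        (continuous_fst.comp continuous_subtype_val).continuousAt ?_
      filter_upwards [hmem] with p hp
      obtain ⟨x, hx⟩ := hp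
      refine arr_ext ?_ rfl
      change p.1.1.left = p.1.2.left
      rw [← p.2, ← hx]
      rfl
    · have hg : g.left ≠ OnePoint.infty := by
        intro hg
        rcases h.hom.down with e | e
        · exact hh (e.trans (w.trans hg))
        · exact e.2 (w.trans hg)
      have ho : IsOpen ({(⟨(g, h), w⟩ : {p : Quiver.Total TOneUnits × Quiver.Total TOneUnits //
          p.2.right = p.1.left})} : Set _) := by
        have := ((isOpen_singleton hg).prod (isOpen_singleton hh)).preimage
          (continuous_subtype_val (p := fun p : Quiver.Total TOneUnits × Quiver.Total TOneUnits =>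
            p.2.right = p.1.left))
        convert this
        ext p
        simp [Subtype.ext_iff, Prod.ext_iff]
      rw [ContinuousAt, isOpen_singleton_iff_nhds_eq_pure _ |>.1 ho]
      exact tendsto_pure_nhds _ _

instance : T2Space (Quiver.Total TOneUnits) := by
  refine ⟨fun g h hne => ?_⟩
  by_cases hl : g.left = h.left
  · have hr : g.right ≠ h.right := fun hr => hne (arr_ext hl hr)
    obtain ⟨U, V, hU, hV, h1, h2, h3⟩ := t2_separation hr
    exact ⟨_, _, hU.preimage continuous_right, hV.preimage continuous_right, h1, h2,
      h3.preimage _⟩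
  · obtain ⟨U, V, hU, hV, h1, h2, h3⟩ := t2_separation hl
    exact ⟨_, _, hU.preimage continuous_left, hV.preimage continuous_left, h1, h2,
      h3.preimage _⟩

instance : IsEtaleGroupoid TOneUnits where
  etale := by
    refine IsLocalHomeomorph.mk _ fun g => ?_
    have : Nonempty TOneUnits := ⟨g.left⟩
    by_cases hg : g.left = OnePoint.infty
    · let e := (isOpenEmbedding_unitArr.toOpenPartialHomeomorph unitArr).symm
      refine ⟨e, ?_, ?_⟩
      · simpa [e] using ⟨g.left, (eq_unitArr hg).symm⟩
      · intro k hk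
        obtain ⟨x, rfl⟩ : k ∈ range unitArr := by simpa [e] using hk
        have := isOpenEmbedding_unitArr.toOpenPartialHomeomorph_left_inv (x := x)
        exact this.symm
    · let e : OpenPartialHomeomorph (Quiver.Total TOneUnits) TOneUnits :=
        { toFun := Quiver.Total.left
          invFun := fun _ => g
          source := {g}
          target := {g.left}
          map_source' := by
            rintro _ rfl
            rfl
          map_target' := fun _ _ => rfl
          left_inv' := by
            rintro _ rfl
            rfl
          right_inv' := by
            rintro _ rfl
            rfl
          open_source := isOpen_singleton hg
          open_target := isOpen_singleton_unit hg
          continuousOn_toFun := continuous_left.continuousOn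
          continuousOn_invFun := continuousOn_const }
      exact ⟨e, rfl, fun _ _ => rfl⟩

instance : IsAmpleGroupoid TOneUnits where
  basis := by
    refine TopologicalSpace.isTopologicalBasis_of_isOpen_of_nhds (fun U hU => hU.2.1) ?_
    intro g W hg hW
    by_cases hl : g.left = OnePoint.infty
    · have hV : IsOpen (unitArr ⁻¹' W) := hW
      have hmem : g.left ∈ unitArr ⁻¹' W := by
        change unitArr g.left ∈ W
        rwa [← eq_unitArr hl]
      have hcl : IsClosed (unitArr ⁻¹' W) := by
        rw [← isOpen_compl_iff, ← biUnion_of_singleton (unitArr ⁻¹' W)ᶜ]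
        refine isOpen_biUnion fun x hx => isOpen_singleton_unit ?_
        rintro rfl
        exact hx (hl ▸ hmem)
      have ho := isOpenEmbedding_unitArr.isOpenMap _ hV
      refine ⟨unitArr '' (unitArr ⁻¹' W), ⟨hcl.isCompact.image isOpenEmbedding_unitArr.continuous,
        ho, isBisection_of_units ho ?_⟩, ⟨g.left, hmem, (eq_unitArr hl).symm⟩,
        image_preimage_subset _ _⟩
      rintro _ ⟨x, -, rfl⟩
      rfl
    · refine ⟨{g}, ⟨isCompact_singleton, isOpen_singleton hl,
        (isBisection_iff (isOpen_singleton hl)).2 ⟨injOn_singleton _ _, injOn_singleton _ _⟩⟩,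
        rfl, singleton_subset_iff.2 hg⟩

end TOneUnits

/-- `B_(T1) = Γ(G_(T1))`. -/
abbrev BTOne : Type := BisectionSemigroup TOneUnits

end NCStone

/-! The orbit space is T₁ exactly when all orbits are closed. Both implications pass through one
condition: some orbit meets some compact open set `K` of units in infinitely many points.

From a non-closed orbit: let `y` be in its closure but not in it, and `K` a compact open
neighbourhood of `y`. If `orbit x₀ ∩ K` were finite, removing it from `K` would leave a
neighbourhood of `y` missing the orbit (`infinite_orbit_inter_of_not_isClosed`). An infinite
Hausdorff space contains an infinite discrete subspace, which gives a sequence `x` in `orbit x₀ ∩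
K`. Bisections that respect this sequence and eventually contain either its units or nothing over it
form `tailSubsemigroup x`. Restricting them to the sequence gives `trace`, with the unit at infinity
recording a unit tail; no convergence of `x` is needed. Pairwise disjoint clopen sets around the `x
n` yield lifts of every element of `B_(T1)` (`surjective_trace`).

From a subquotient `π : C → B_(T1)`: compactness pulls the unit `0` back to a unit `x` of the
groupoid (`exists_unit_of_isBooleanMorphism`). The bisections `{0 → n}` lift to elements of `C`
whose ranges lie in one compact open set, because `B_(T1)` has an identity. Their arrows out of `x`
have distinct ranges, so the orbit of `x` meets that set infinitely often. Under second countability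
orbits are countable; a closed orbit then meets `K` in a countable compact Hausdorff space, which
has an isolated point by Baire, is discrete by homogeneity, and so is finite (`finite_orbit_inter`).
-/

namespace NCStone

/-! ### Orbits and the T₁ property of the orbit space. -/

section Orbits

variable {X : Type u} [Groupoid.{v} X]

/-- The orbit of a unit. -/
def orbit (x : X) : Set X := {y | ∃ g : Quiver.Total X, g.left = x ∧ g.right = y}

theorem orbit_symm {x y : X} (h : y ∈ orbit x) : x ∈ orbit y := by
  obtain ⟨g, h1, h2⟩ := h
  exact ⟨invArr g, h2, h1⟩

theorem orbit_trans {x y z : X} (h : y ∈ orbit x) (h' : z ∈ orbit y) : z ∈ orbit x := by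
  obtain ⟨g, h1, h2⟩ := h
  obtain ⟨k, h3, h4⟩ := h'
  exact ⟨mulArr k g (h2.trans h3.symm), h1, h4⟩

theorem preimage_mk_singleton (x : X) :
    (Quotient.mk (isIsomorphicSetoid X)) ⁻¹' {Quotient.mk _ x} = orbit x := by
  ext y
  rw [mem_preimage, mem_singleton_iff, Quotient.eq]
  constructor
  · rintro ⟨i⟩
    exact ⟨⟨x, y, i.inv⟩, rfl, rfl⟩
  · rintro ⟨⟨a, b, g⟩, rfl, rfl⟩
    exact ⟨(asIso g).symm⟩

theorem t1Space_orbitSpace_iff [TopologicalSpace X] :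
    T1Space (OrbitSpace X) ↔ ∀ x : X, IsClosed (orbit x) := by
  have key : ∀ x : X, IsClosed ({Quotient.mk _ x} : Set (OrbitSpace X)) ↔ IsClosed (orbit x) := by
    intro x
    rw [← preimage_mk_singleton, ← isQuotientMap_quotient_mk'.isClosed_preimage]
    rfl
  constructor
  · intro h x
    exact (key x).1 isClosed_singleton
  · intro h
    refine ⟨fun q => ?_⟩
    induction q using Quotient.inductionOn with
    | h x => exact (key x).2 (h x)

end Orbits

/-! ### Compact open sets of units, and the operations of `Γ(G)` as set operations. -/

section Ample

variable {X : Type u} [Groupoid.{v} X] [TopologicalSpace X] [TopologicalSpace (Quiver.Total X)]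

open IsTopologicalGroupoid IsEtaleGroupoid

/-- The unit map is a continuous section of the local homeomorphism `d`, hence itself a local
homeomorphism. -/
theorem isOpenEmbedding_unitArr [IsEtaleGroupoid X] :
    IsOpenEmbedding (unitArr : X → Quiver.Total X) := by
  refine (IsLocalHomeomorph.of_comp (g := Quiver.Total.left) ?_ etale
    continuous_unit).isOpenEmbedding_of_injective fun _ _ h => congrArg Quiver.Total.left h
  exact (Homeomorph.refl X).isLocalHomeomorph

theorem exists_bisection_subset [IsAmpleGroupoid X] {W : Set (Quiver.Total X)} (hW : IsOpen W)
    {g : Quiver.Total X} (hg : g ∈ W) :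
    ∃ U : BisectionSemigroup X, g ∈ U.carrier ∧ U.carrier ⊆ W := by
  obtain ⟨U, ⟨h1, h2, h3⟩, h4, h5⟩ :=
    (IsAmpleGroupoid.basis (X := X)).exists_subset_of_mem_open hg hW
  exact ⟨⟨U, h1, h2, h3⟩, h4, h5⟩

theorem exists_compact_open_units [IsAmpleGroupoid X] {V : Set X} (hV : IsOpen V) {x : X}
    (hx : x ∈ V) : ∃ D ⊆ V, IsCompact D ∧ IsOpen D ∧ x ∈ D := by
  obtain ⟨U, hg, hU⟩ := exists_bisection_subset
    (isOpenEmbedding_unitArr.isOpenMap V hV) (mem_image_of_mem unitArr hx)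
  refine ⟨Quiver.Total.left '' U.carrier, ?_, U.isCompact.image continuous_source,
    etale.isOpenMap _ U.isOpen, _, hg, rfl⟩
  rintro _ ⟨g, hg, rfl⟩
  obtain ⟨y, hy, rfl⟩ := hU hg
  exact hy

theorem IsBisection.mono [IsEtaleGroupoid X] {U V : Set (Quiver.Total X)} (hV : IsBisection V)
    (hU : IsOpen U) (h : U ⊆ V) : IsBisection U :=
  (isBisection_iff hU).2 ⟨fun _ hg _ hk => hV.eq_of_left (h hg) (h hk),
    fun _ hg _ hk => hV.eq_of_right (h hg) (h hk)⟩

namespace BisectionSemigroup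

variable [IsAmpleGroupoid X] [T2Space (Quiver.Total X)]

/-- Once any upper bound exists, the union lies inside a bisection, so it is itself a bisection and
the least upper bound. -/
theorem isJoin_iff {U V W : BisectionSemigroup X} :
    IsJoin U V W ↔ W.carrier = U.carrier ∪ V.carrier := by
  constructor
  · rintro ⟨hU, hV, hW⟩
    have h := union_subset ((natLE_iff _ _).1 hU) ((natLE_iff _ _).1 hV)
    have ho := U.isOpen.union V.isOpen
    refine Subset.antisymm ((natLE_iff _ _).1 (hW ⟨_, U.isCompact.union V.isCompact, ho,
      W.isBisection.mono ho h⟩ ?_ ?_)) h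
    · exact (natLE_iff _ _).2 subset_union_left
    · exact (natLE_iff _ _).2 subset_union_right
  · intro h
    refine ⟨(natLE_iff _ _).2 (h ▸ subset_union_left), (natLE_iff _ _).2 (h ▸ subset_union_right),
      fun Z hU hV => (natLE_iff _ _).2 ?_⟩
    rw [h]
    exact union_subset ((natLE_iff _ _).1 hU) ((natLE_iff _ _).1 hV)

theorem carrier_mul_of_idem {U V : BisectionSemigroup X} (hU : U * U = U) (hV : V * V = V) :
    (U * V).carrier = U.carrier ∩ V.carrier := by
  ext k
  constructor
  · rintro ⟨g, hg, h, hh, w, rfl⟩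
    have e1 := mem_of_idem hU hg
    have e2 := mem_of_idem hV hh
    have e3 : h = g := by
      have w' := w
      rw [e2] at w'
      have w' : h.left = g.left := w'
      rw [e1, e2, w']
    subst e3
    have : mulArr h h w = h := by
      conv_rhs => rw [← mulArr_unitArr h h.left rfl]
      congr 1
    rw [this]
    exact ⟨hg, hh⟩
  · rintro ⟨h1, h2⟩
    have e := mem_of_idem hV h2
    refine ⟨k, h1, unitArr k.left, e ▸ h2, rfl, (mulArr_unitArr k k.left rfl).symm⟩

theorem exists_isRelCompl {e f : BisectionSemigroup X} (he : e * e = e) (hf : f * f = f) :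
    ∃ g, IsRelCompl f e g ∧ g.carrier = f.carrier \ e.carrier := by
  let g := ofUnits (f.carrier \ e.carrier) (f.isCompact.diff e.isOpen)
    (f.isOpen.sdiff e.isCompact.isClosed) (fun _ hg => mem_of_idem hf hg.1)
  refine ⟨g.1, ⟨⟨g.2, ?_, ?_⟩, ?_⟩, rfl⟩
  · apply BisectionSemigroup.ext
    rw [carrier_mul_of_idem g.2 hf]
    exact inter_eq_left.2 sdiff_subset
  · apply BisectionSemigroup.ext
    rw [carrier_mul_of_idem g.2 he]
    exact sdiff_inter_self
  · intro h hh h1 h2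
    apply BisectionSemigroup.ext
    have h1 := congrArg carrier h1
    have h2 := congrArg carrier h2
    rw [carrier_mul_of_idem hh hf] at h1
    rw [carrier_mul_of_idem hh he] at h2
    rw [carrier_mul_of_idem hh g.2]
    refine inter_eq_left.2 fun k hk => ⟨inter_eq_left.1 h1 hk, fun hk' => ?_⟩
    have : k ∈ h.carrier ∩ e.carrier := ⟨hk, hk'⟩
    rwa [h2] at this

/-- Relative complements are unique: two of them lie below each other, and idempotents commute. -/
theorem carrier_of_isRelCompl {e f g : BisectionSemigroup X} (he : e * e = e) (hf : f * f = f)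
    (h : IsRelCompl f e g) : g.carrier = f.carrier \ e.carrier := by
  obtain ⟨g', h', hg'⟩ := exists_isRelCompl he hf
  have h1 := h'.2 g h.1.1 h.1.2.1 h.1.2.2
  have h2 := h.2 g' h'.1.1 h'.1.2.1 h'.1.2.2
  rw [← hg', ← h1, idem_comm h.1.1 h'.1.1, h2]

end BisectionSemigroup

end Ample

/-! ### Arrows of `G_(T1)` and the shape of its compact open bisections. -/

namespace TOneUnits

/-- The finite points of `ℕ ∪ {∞}`. -/
def fin (n : ℕ) : TOneUnits := OnePoint.some n

theorem fin_injective : Function.Injective fin := OnePoint.coe_injective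

theorem fin_ne_infty (n : ℕ) : fin n ≠ OnePoint.infty := OnePoint.coe_ne_infty n

theorem eq_fin_or_infty (z : TOneUnits) : (∃ n, z = fin n) ∨ z = OnePoint.infty := by
  induction z using OnePoint.rec with
  | infty => exact Or.inr rfl
  | coe n => exact Or.inl ⟨n, rfl⟩

/-- The arrow from the finite point `n` to the finite point `m`. -/
def arr (n m : ℕ) : Quiver.Total TOneUnits :=
  ⟨fin n, fin m, ⟨Or.inr ⟨fin_ne_infty n, fin_ne_infty m⟩⟩⟩

/-- The unit at infinity. -/
def arrInfty : Quiver.Total TOneUnits := unitArr (X := TOneUnits) OnePoint.infty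

theorem unitArr_fin (n : ℕ) : unitArr (fin n) = arr n n := arr_ext rfl rfl

theorem arr_inj {n m n' m' : ℕ} : arr n m = arr n' m' ↔ n = n' ∧ m = m' := by
  constructor
  · intro h
    exact ⟨fin_injective (congrArg Quiver.Total.left h),
      fin_injective (congrArg Quiver.Total.right h)⟩
  · rintro ⟨rfl, rfl⟩
    rfl

theorem arr_ne_arrInfty (n m : ℕ) : arr n m ≠ arrInfty :=
  fun h => fin_ne_infty n (congrArg Quiver.Total.left h)

theorem arr_cases (k : Quiver.Total TOneUnits) : (∃ n m, k = arr n m) ∨ k = arrInfty := by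
  rcases eq_fin_or_infty k.left with ⟨n, hn⟩ | h
  · rcases eq_fin_or_infty k.right with ⟨m, hm⟩ | h'
    · exact Or.inl ⟨n, m, arr_ext hn hm⟩
    · rcases k.hom.down with e | e
      · exact (fin_ne_infty n (hn.symm.trans (e.trans h'))).elim
      · exact (e.2 h').elim
  · right
    rw [eq_unitArr h, h]
    rfl

theorem set_ext {A B : Set (Quiver.Total TOneUnits)} (h : ∀ n m, arr n m ∈ A ↔ arr n m ∈ B)
    (h' : arrInfty ∈ A ↔ arrInfty ∈ B) : A = B := by
  ext k
  rcases arr_cases k with ⟨n, m, rfl⟩ | rfl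
  · exact h n m
  · exact h'

theorem arr_mem_mulSet {A B : Set (Quiver.Total TOneUnits)} {n m : ℕ} :
    arr n m ∈ mulSet A B ↔ ∃ l, arr l m ∈ A ∧ arr n l ∈ B := by
  constructor
  · rintro ⟨g, hg, h, hh, w, e⟩
    rcases arr_cases g with ⟨a, b, rfl⟩ | rfl
    · rcases arr_cases h with ⟨c, d, rfl⟩ | rfl
      · obtain rfl : d = a := fin_injective w
        obtain rfl : n = c := fin_injective (congrArg Quiver.Total.left e)
        obtain rfl : m = b := fin_injective (congrArg Quiver.Total.right e)
        exact ⟨d, hg, hh⟩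
      · exact (fin_ne_infty _ w.symm).elim
    · exact (fin_ne_infty _ (congrArg Quiver.Total.right e)).elim
  · rintro ⟨l, h1, h2⟩
    exact ⟨_, h1, _, h2, rfl, arr_ext rfl rfl⟩

theorem arrInfty_mem_mulSet {A B : Set (Quiver.Total TOneUnits)} :
    arrInfty ∈ mulSet A B ↔ arrInfty ∈ A ∧ arrInfty ∈ B := by
  constructor
  · rintro ⟨g, hg, h, hh, w, e⟩
    rcases arr_cases g with ⟨a, b, rfl⟩ | rfl
    · exact (fin_ne_infty _ (congrArg Quiver.Total.right e).symm).elim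
    · rcases arr_cases h with ⟨c, d, rfl⟩ | rfl
      · exact (fin_ne_infty _ (congrArg Quiver.Total.left e).symm).elim
      · exact ⟨hg, hh⟩
  · rintro ⟨h1, h2⟩
    exact ⟨_, h1, _, h2, rfl, arr_ext rfl rfl⟩

/-- Neighbourhoods of infinity have compact complement in the discrete space `ℕ`, that is, finite
complement. -/
theorem isOpen_iff_tail {V : Set TOneUnits} (h : OnePoint.infty ∈ V) :
    IsOpen V ↔ ∃ N, ∀ n ≥ N, fin n ∈ V := by
  have : IsOpen V ↔ IsClosed (fin ⁻¹' V)ᶜ ∧ IsCompact (fin ⁻¹' V)ᶜ :=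
    OnePoint.isOpen_iff_of_mem (X := ℕ) h
  rw [this]
  constructor
  · rintro ⟨-, hc⟩
    obtain ⟨N, hN⟩ := hc.finite_of_discrete.bddAbove
    refine ⟨N + 1, fun n hn => ?_⟩
    by_contra hn'
    have := hN hn'
    omega
  · rintro ⟨N, hN⟩
    have hf : ((fin ⁻¹' V)ᶜ).Finite := (finite_lt_nat N).subset fun n hn => by
      by_contra hn'
      exact hn (hN n (not_lt.1 hn'))
    exact ⟨hf.isClosed, hf.isCompact⟩

theorem isOpen_of_notMem {V : Set TOneUnits} (h : OnePoint.infty ∉ V) : IsOpen V := by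
  rw [← biUnion_of_singleton V]
  refine isOpen_biUnion fun x hx => isOpen_singleton_unit ?_
  rintro rfl
  exact h hx

theorem isOpen_of_tail {A : Set (Quiver.Total TOneUnits)}
    (h : arrInfty ∈ A → ∃ N, ∀ n ≥ N, arr n n ∈ A) : IsOpen A := by
  rw [isOpen_arrows]
  by_cases hA : arrInfty ∈ A
  · obtain ⟨N, hN⟩ := h hA
    refine (isOpen_iff_tail hA).2 ⟨N, fun n hn => ?_⟩
    rw [mem_preimage, unitArr_fin]
    exact hN n hn
  · exact isOpen_of_notMem hA

/-- Injectivity of `d` leaves only finitely many arrows starting below `N`. What remains is either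
empty or the image under `unitArr` of a compact set of units. -/
theorem isCompact_of_tail {A : Set (Quiver.Total TOneUnits)} (hA : InjOn Quiver.Total.left A)
    {N : ℕ} (h : (arrInfty ∈ A ∧ ∀ n ≥ N, arr n n ∈ A) ∨
      (arrInfty ∉ A ∧ ∀ n ≥ N, ∀ m, arr n m ∉ A)) : IsCompact A := by
  have hfin : (A ∩ {k | ∃ n < N, k.left = fin n}).Finite := by
    refine Finite.of_finite_image (((finite_lt_nat N).image fin).subset ?_)
      (hA.mono inter_subset_left)
    rintro _ ⟨k, ⟨-, n, hn, e⟩, rfl⟩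
    exact ⟨n, hn, e.symm⟩
  rcases h with ⟨h1, h2⟩ | ⟨h1, h2⟩
  · have ho : IsOpen {z : TOneUnits | ∃ n < N, z = fin n} := by
      refine isOpen_of_notMem ?_
      rintro ⟨n, -, e⟩
      exact fin_ne_infty n e.symm
    convert hfin.isCompact.union
      (ho.isClosed_compl.isCompact.image isOpenEmbedding_unitArr.continuous) using 1
    have hU : ∀ z, z ∉ {z : TOneUnits | ∃ n < N, z = fin n} → unitArr z ∈ A := by
      intro z hz
      rcases eq_fin_or_infty z with ⟨n, rfl⟩ | rfl
      · rw [unitArr_fin]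
        refine h2 n (not_lt.1 fun hn => hz ⟨n, hn, rfl⟩)
      · exact h1
    ext k
    constructor
    · intro hk
      by_cases hk' : ∃ n < N, k.left = fin n
      · exact Or.inl ⟨hk, hk'⟩
      -- The unit at the source of `k` is already in `A`, so injectivity of `d` forces `k` to be
      -- that unit.
      · exact Or.inr ⟨k.left, hk', hA (hU _ hk') hk rfl⟩
    · rintro (hk | ⟨z, hz, rfl⟩)
      · exact hk.1
      · exact hU z hz
  · convert hfin.isCompact using 1
    refine (inter_eq_left.2 fun k hk => ?_).symm
    rcases arr_cases k with ⟨n, m, rfl⟩ | rfl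
    · exact ⟨n, not_le.1 fun hn => h2 n hn m hk, rfl⟩
    · exact (h1 hk).elim

/-- Normal form for elements of `B_(T1)`: finitely many arrows among the points below `N`, together
with either all units from `N` on and at infinity, or nothing. This is what the surjectivity proof
has to lift. -/
theorem exists_tail (W : BTOne) : ∃ N, (∀ n m, arr n m ∈ W.carrier → n < N → m < N) ∧
    ((arrInfty ∈ W.carrier ∧ ∀ n ≥ N, ∀ m, arr n m ∈ W.carrier ↔ m = n) ∨
      (arrInfty ∉ W.carrier ∧ ∀ n ≥ N, ∀ m, arr n m ∉ W.carrier)) := by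
  by_cases hW : arrInfty ∈ W.carrier
  · have ho : IsOpen (unitArr ⁻¹' W.carrier) := W.isOpen
    obtain ⟨N, hN⟩ := (isOpen_iff_tail hW).1 ho
    have hN' : ∀ n ≥ N, arr n n ∈ W.carrier := by
      intro n hn
      rw [← unitArr_fin]
      exact hN n hn
    refine ⟨N, fun n m h hn => ?_, Or.inl ⟨hW, fun n hn m => ⟨fun h => ?_, ?_⟩⟩⟩
    · by_contra hm
      have := W.isBisection.eq_of_right h (hN' m (not_lt.1 hm)) rfl
      rw [arr_inj] at this
      omega
    · have := W.isBisection.eq_of_left h (hN' n hn) rfl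
      exact (arr_inj.1 this).2
    · rintro rfl
      exact hN' m hn
  -- For `f` either the source or the range map, the image of `W` is compact, hence closed, and
  -- misses infinity; so it misses a tail.
  · have key : ∀ f : Quiver.Total TOneUnits → TOneUnits, Continuous f →
        (∀ k, f k = OnePoint.infty → k = arrInfty) →
        ∃ N, ∀ n ≥ N, ∀ k ∈ W.carrier, f k ≠ fin n := by
      intro f hf h
      have ho : IsOpen (f '' W.carrier)ᶜ := (W.isCompact.image hf).isClosed.isOpen_compl
      have hmem : (OnePoint.infty : TOneUnits) ∈ (f '' W.carrier)ᶜ := by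
        rintro ⟨k, hk, e⟩
        exact hW (h k e ▸ hk)
      obtain ⟨N, hN⟩ := (isOpen_iff_tail hmem).1 ho
      exact ⟨N, fun n hn k hk e => hN n hn ⟨k, hk, e⟩⟩
    obtain ⟨N, hN⟩ := key _ continuous_left fun k hk => by
      rcases arr_cases k with ⟨n, m, rfl⟩ | rfl
      · exact (fin_ne_infty n hk).elim
      · rfl
    obtain ⟨M, hM⟩ := key _ continuous_right fun k hk => by
      rcases arr_cases k with ⟨n, m, rfl⟩ | rfl
      · exact (fin_ne_infty m hk).elim
      · rfl
    refine ⟨max N M, fun n m h _ => ?_, Or.inr ⟨hW, fun n hn m h => ?_⟩⟩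
    · by_contra hm
      exact hM m ((le_max_right N M).trans (not_lt.1 hm)) _ h rfl
    · exact hN n ((le_max_left N M).trans hn) _ h rfl

end TOneUnits

/-! ### Tail conditions along a sequence of units, and restriction to the sequence. -/

section Trace

variable {X : Type u} [Groupoid.{v} X]

/-- `U` contains the units at all but finitely many terms of the sequence `x`. -/
def HasUnitTail (x : ℕ → X) (U : Set (Quiver.Total X)) : Prop :=
  ∃ N, ∀ n ≥ N, unitArr (x n) ∈ U

/-- No arrow of `U` starts or ends at all but finitely many terms of the sequence `x`. -/
def HasEmptyTail (x : ℕ → X) (U : Set (Quiver.Total X)) : Prop :=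
  ∃ N, ∀ n ≥ N, ∀ g ∈ U, g.left ≠ x n ∧ g.right ≠ x n

/-- `U` maps terms of the sequence `x` to terms of `x`, and other units to other units. -/
def PreservesRange (x : ℕ → X) (U : Set (Quiver.Total X)) : Prop :=
  ∀ g ∈ U, g.left ∈ range x ↔ g.right ∈ range x

/-- The arrows of `G_(T1)` obtained by restricting `U` to the sequence `x` and forgetting
isotropy. -/
def traceSet (x : ℕ → X) (U : Set (Quiver.Total X)) : Set (Quiver.Total TOneUnits) :=
  {k | (∃ n m, k = TOneUnits.arr n m ∧ ∃ g ∈ U, g.left = x n ∧ g.right = x m) ∨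
    (k = TOneUnits.arrInfty ∧ HasUnitTail x U)}

variable {x : ℕ → X} {U V : Set (Quiver.Total X)}

theorem arr_mem_traceSet {n m : ℕ} :
    TOneUnits.arr n m ∈ traceSet x U ↔ ∃ g ∈ U, g.left = x n ∧ g.right = x m := by
  constructor
  · rintro (⟨a, b, e, h⟩ | ⟨e, -⟩)
    · obtain ⟨rfl, rfl⟩ := TOneUnits.arr_inj.1 e
      exact h
    · exact (TOneUnits.arr_ne_arrInfty n m e).elim
  · exact fun h => Or.inl ⟨n, m, rfl, h⟩

theorem arrInfty_mem_traceSet : TOneUnits.arrInfty ∈ traceSet x U ↔ HasUnitTail x U := by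
  constructor
  · rintro (⟨a, b, e, h⟩ | ⟨-, h⟩)
    · exact (TOneUnits.arr_ne_arrInfty a b e.symm).elim
    · exact h
  · exact fun h => Or.inr ⟨rfl, h⟩

theorem HasUnitTail.mono (h : HasUnitTail x U) (hUV : U ⊆ V) : HasUnitTail x V := by
  obtain ⟨N, hN⟩ := h
  exact ⟨N, fun n hn => hUV (hN n hn)⟩

theorem HasEmptyTail.mono (h : HasEmptyTail x V) (hUV : U ⊆ V) : HasEmptyTail x U := by
  obtain ⟨N, hN⟩ := h
  exact ⟨N, fun n hn g hg => hN n hn g (hUV hg)⟩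

theorem HasUnitTail.not_hasEmptyTail (h : HasUnitTail x U) : ¬ HasEmptyTail x U := by
  rintro ⟨M, hM⟩
  obtain ⟨N, hN⟩ := h
  exact (hM (max N M) (le_max_right _ _) _ (hN _ (le_max_left _ _))).1 rfl

theorem HasUnitTail.inter (hU : HasUnitTail x U) (hV : HasUnitTail x V) :
    HasUnitTail x (U ∩ V) := by
  obtain ⟨N, hN⟩ := hU
  obtain ⟨M, hM⟩ := hV
  exact ⟨max N M, fun n hn => ⟨hN n ((le_max_left _ _).trans hn),
    hM n ((le_max_right _ _).trans hn)⟩⟩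

theorem HasEmptyTail.union (hU : HasEmptyTail x U) (hV : HasEmptyTail x V) :
    HasEmptyTail x (U ∪ V) := by
  obtain ⟨N, hN⟩ := hU
  obtain ⟨M, hM⟩ := hV
  refine ⟨max N M, fun n hn g hg => ?_⟩
  rcases hg with hg | hg
  · exact hN n ((le_max_left _ _).trans hn) g hg
  · exact hM n ((le_max_right _ _).trans hn) g hg

theorem HasUnitTail.mulSet (hU : HasUnitTail x U) (hV : HasUnitTail x V) :
    HasUnitTail x (mulSet U V) := by
  obtain ⟨N, hN⟩ := hU.inter hV
  exact ⟨N, fun n hn => ⟨_, (hN n hn).1, _, (hN n hn).2, rfl, (mulArr_unitArr _ _ rfl).symm⟩⟩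

theorem HasUnitTail.invSet (hU : HasUnitTail x U) : HasUnitTail x (NCStone.invSet U) := by
  obtain ⟨N, hN⟩ := hU
  refine ⟨N, fun n hn => ?_⟩
  change invArr (unitArr (x n)) ∈ U
  convert hN n hn using 1
  simp [invArr, unitArr]

theorem HasEmptyTail.invSet (hU : HasEmptyTail x U) : HasEmptyTail x (NCStone.invSet U) := by
  obtain ⟨N, hN⟩ := hU
  exact ⟨N, fun n hn _ hg => (hN n hn _ hg).symm⟩

theorem PreservesRange.invSet (hU : PreservesRange x U) : PreservesRange x (NCStone.invSet U) :=
  fun _ hg => (hU _ hg).symm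

theorem PreservesRange.mulSet (hU : PreservesRange x U) (hV : PreservesRange x V) :
    PreservesRange x (NCStone.mulSet U V) := by
  rintro _ ⟨g, hg, h, hh, w, rfl⟩
  change h.left ∈ range x ↔ g.right ∈ range x
  rw [hV h hh, w, hU g hg]

theorem PreservesRange.union (hU : PreservesRange x U) (hV : PreservesRange x V) :
    PreservesRange x (U ∪ V) :=
  fun g hg => hg.elim (hU g) (hV g)

theorem preservesRange_of_units (h : ∀ g ∈ U, g = unitArr g.left) : PreservesRange x U := by
  intro g hg
  rw [h g hg]
  rfl

/-- Far out, the only arrow of the bisection `U` ending at `x n` is the unit, so a product ending at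
`x n` would need an arrow of `V` ending there. -/
theorem HasUnitTail.mulSet_hasEmptyTail [TopologicalSpace X] [TopologicalSpace (Quiver.Total X)]
    (hUb : IsBisection U) (hU : HasUnitTail x U) (hV : HasEmptyTail x V) :
    HasEmptyTail x (NCStone.mulSet U V) := by
  obtain ⟨N, hN⟩ := hU
  obtain ⟨M, hM⟩ := hV
  refine ⟨max N M, ?_⟩
  rintro n hn _ ⟨g, hg, h, hh, w, rfl⟩
  have hM' := hM n ((le_max_right _ _).trans hn) h hh
  refine ⟨hM'.1, fun e => hM'.2 ?_⟩
  obtain rfl : g = unitArr (x n) :=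
    hUb.eq_of_right hg (hN n ((le_max_left _ _).trans hn)) e
  exact w

theorem HasEmptyTail.mulSet_hasUnitTail [TopologicalSpace X] [TopologicalSpace (Quiver.Total X)]
    (hVb : IsBisection V) (hU : HasEmptyTail x U) (hV : HasUnitTail x V) :
    HasEmptyTail x (NCStone.mulSet U V) := by
  obtain ⟨N, hN⟩ := hU
  obtain ⟨M, hM⟩ := hV
  refine ⟨max N M, ?_⟩
  rintro n hn _ ⟨g, hg, h, hh, w, rfl⟩
  have hN' := hN n ((le_max_left _ _).trans hn) g hg
  refine ⟨fun e => hN'.1 ?_, hN'.2⟩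
  obtain rfl : h = unitArr (x n) :=
    hVb.eq_of_left hh (hM n ((le_max_right _ _).trans hn)) e
  exact w.symm

theorem HasEmptyTail.mulSet (hU : HasEmptyTail x U) (hV : HasEmptyTail x V) :
    HasEmptyTail x (NCStone.mulSet U V) := by
  obtain ⟨N, hN⟩ := hU
  obtain ⟨M, hM⟩ := hV
  refine ⟨max N M, ?_⟩
  rintro n hn _ ⟨g, hg, h, hh, w, rfl⟩
  exact ⟨(hM n ((le_max_right _ _).trans hn) h hh).1,
    (hN n ((le_max_left _ _).trans hn) g hg).2⟩

end Trace

/-! ### From an infinite piece of an orbit to the subquotient `B_(T1)`. -/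

section Ample

variable {X : Type u} [Groupoid.{v} X] [TopologicalSpace X] [TopologicalSpace (Quiver.Total X)]
  [IsAmpleGroupoid X] [T2Space (Quiver.Total X)]

open BisectionSemigroup

/-- The compact open bisections that restrict to the sequence `x`, where they have either a unit
tail or an empty tail. -/
def tailSubsemigroup (x : ℕ → X) : BooleanInverseSubsemigroup (BisectionSemigroup X) where
  carrier := {U | PreservesRange x U.carrier ∧
    (HasUnitTail x U.carrier ∨ HasEmptyTail x U.carrier)}
  mul_mem := by
    rintro U V ⟨hU, hU'⟩ ⟨hV, hV'⟩
    refine ⟨hU.mulSet hV, ?_⟩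
    rcases hU' with hU' | hU' <;> rcases hV' with hV' | hV'
    · exact Or.inl (hU'.mulSet hV')
    · exact Or.inr (hU'.mulSet_hasEmptyTail U.isBisection hV')
    · exact Or.inr (hU'.mulSet_hasUnitTail V.isBisection hV')
    · exact Or.inr (hU'.mulSet hV')
  inv_mem := by
    rintro U ⟨hU, hU'⟩
    exact ⟨hU.invSet, hU'.imp HasUnitTail.invSet HasEmptyTail.invSet⟩
  zero_mem := ⟨fun _ hg => hg.elim, Or.inr ⟨0, fun _ _ _ hg => hg.elim⟩⟩
  relCompl_mem := by
    rintro e f g ⟨-, he'⟩ ⟨-, hf'⟩ he hf h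
    refine ⟨preservesRange_of_units fun k hk => mem_of_idem h.1.1 hk, ?_⟩
    rw [carrier_of_isRelCompl he hf h]
    -- The tail of `f \ e` is a unit tail only when `f` has a unit tail and `e` an empty one.
    rcases hf' with hf' | hf'
    · rcases he' with he' | he'
      · right
        obtain ⟨N, hN⟩ := he'
        refine ⟨N, fun n hn k hk => ?_⟩
        have hk' := mem_of_idem hf hk.1
        have : k.left ≠ x n := fun e => hk.2 (by rw [hk', e]; exact hN n hn)
        exact ⟨this, by rwa [hk']⟩
      · left
        obtain ⟨N, hN⟩ := hf'
        obtain ⟨M, hM⟩ := he'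
        exact ⟨max N M, fun n hn => ⟨hN n ((le_max_left _ _).trans hn),
          fun hk => (hM n ((le_max_right _ _).trans hn) _ hk).1 rfl⟩⟩
    · exact Or.inr (hf'.mono sdiff_subset)
  join_mem := by
    rintro U V W ⟨hU, hU'⟩ ⟨hV, hV'⟩ - h
    change PreservesRange x W.carrier ∧ (HasUnitTail x W.carrier ∨ HasEmptyTail x W.carrier)
    rw [isJoin_iff.1 h]
    refine ⟨hU.union hV, ?_⟩
    rcases hU' with hU' | hU'
    · exact Or.inl (hU'.mono subset_union_left)
    · rcases hV' with hV' | hV'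
      · exact Or.inl (hV'.mono subset_union_right)
      · exact Or.inr (hU'.union hV')

/-- Joins in a Boolean inverse subsemigroup of `Γ(G)` are unions. -/
theorem isJoin_coe {C : BooleanInverseSubsemigroup (BisectionSemigroup X)} {U V W : C.carrier}
    (h : Orthogonal U V) : IsJoin U V W ↔ IsJoin U.1 V.1 W.1 := by
  have key : ∀ {W : C.carrier}, IsJoin U.1 V.1 W.1 → IsJoin U V W := by
    rintro W ⟨h1, h2, h3⟩
    simp only [IsJoin, C.natLE_coe]
    exact ⟨h1, h2, fun Z => h3 Z.1⟩
  refine ⟨fun hW => ?_, key⟩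
  have h' := (C.orthogonal_coe U V).1 h
  obtain ⟨Z, hZ⟩ := BooleanInverseSemigroup.exists_join _ _ h'
  -- The join taken in `Γ(G)` belongs to `C` and is a join there, so it coincides with the given
  -- one.
  obtain rfl : W = ⟨Z, C.join_mem U.2 V.2 h' hZ⟩ := hW.unique (key hZ)
  exact hZ

/-- The restriction of a bisection to the sequence `x`, as an element of `B_(T1)`. -/
def trace (x : ℕ → X) (hx : Function.Injective x) (U : (tailSubsemigroup x).carrier) : BTOne :=
  have hl : InjOn Quiver.Total.left (traceSet x U.1.carrier) := by
    intro k hk l hl e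
    rcases hk with ⟨n, m, rfl, g, hg, h1, h2⟩ | ⟨rfl, -⟩ <;>
      rcases hl with ⟨n', m', rfl, g', hg', h1', h2'⟩ | ⟨rfl, -⟩
    · obtain rfl := TOneUnits.fin_injective e
      obtain rfl := U.1.isBisection.eq_of_left hg hg' (h1.trans h1'.symm)
      obtain rfl := hx (h2.symm.trans h2')
      rfl
    · exact (TOneUnits.fin_ne_infty _ e).elim
    · exact (TOneUnits.fin_ne_infty _ e.symm).elim
    · rfl
  have hr : InjOn Quiver.Total.right (traceSet x U.1.carrier) := by
    intro k hk l hl e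
    rcases hk with ⟨n, m, rfl, g, hg, h1, h2⟩ | ⟨rfl, -⟩ <;>
      rcases hl with ⟨n', m', rfl, g', hg', h1', h2'⟩ | ⟨rfl, -⟩
    · obtain rfl := TOneUnits.fin_injective e
      obtain rfl := U.1.isBisection.eq_of_right hg hg' (h2.trans h2'.symm)
      obtain rfl := hx (h1.symm.trans h1')
      rfl
    · exact (TOneUnits.fin_ne_infty _ e).elim
    · exact (TOneUnits.fin_ne_infty _ e.symm).elim
    · rfl
  have ho : IsOpen (traceSet x U.1.carrier) := by
    refine TOneUnits.isOpen_of_tail fun h => ?_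
    obtain ⟨N, hN⟩ := arrInfty_mem_traceSet.1 h
    exact ⟨N, fun n hn => arr_mem_traceSet.2 ⟨_, hN n hn, rfl, rfl⟩⟩
  { carrier := traceSet x U.1.carrier
    isCompact := by
      rcases U.2.2 with h | h
      · have ⟨N, hN⟩ := h
        exact TOneUnits.isCompact_of_tail hl (N := N) (Or.inl ⟨arrInfty_mem_traceSet.2 h,
          fun n hn => arr_mem_traceSet.2 ⟨_, hN n hn, rfl, rfl⟩⟩)
      · have ⟨N, hN⟩ := h
        refine TOneUnits.isCompact_of_tail hl (N := N) (Or.inr ⟨fun h' =>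
          (arrInfty_mem_traceSet.1 h').not_hasEmptyTail h, fun n hn m hm => ?_⟩)
        obtain ⟨g, hg, e, -⟩ := arr_mem_traceSet.1 hm
        exact (hN n hn g hg).1 e
    isOpen := ho
    isBisection := (isBisection_iff ho).2 ⟨hl, hr⟩ }

/-- `PreservesRange` makes restriction multiplicative at finite points. At infinity, the dichotomy
between unit tails and empty tails does the work. -/
theorem isBooleanMorphism_trace (x : ℕ → X) (hx : Function.Injective x) :
    IsBooleanMorphism (trace x hx) where
  map_mul U V := by
    apply BisectionSemigroup.ext
    rw [carrier_mul]
    change traceSet x (mulSet U.1.carrier V.1.carrier) =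
      mulSet (traceSet x U.1.carrier) (traceSet x V.1.carrier)
    refine TOneUnits.set_ext (fun n m => ?_) ?_
    · rw [TOneUnits.arr_mem_mulSet, arr_mem_traceSet]
      simp only [arr_mem_traceSet]
      constructor
      · rintro ⟨_, ⟨g, hg, h, hh, w, rfl⟩, h1, h2⟩
        -- The middle unit of the composable pair is again a term of the sequence.
        obtain ⟨l, hl⟩ := (V.2.1 h hh).1 ⟨n, h1.symm⟩
        exact ⟨l, ⟨g, hg, w.symm.trans hl.symm, h2⟩, h, hh, h1, hl.symm⟩
      · rintro ⟨l, ⟨g, hg, h1, h2⟩, h, hh, h3, h4⟩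
        exact ⟨_, ⟨g, hg, h, hh, h4.trans h1.symm, rfl⟩, h3, h2⟩
    · rw [TOneUnits.arrInfty_mem_mulSet]
      simp only [arrInfty_mem_traceSet]
      refine ⟨fun h => ⟨?_, ?_⟩, fun h => h.1.mulSet h.2⟩
      · refine U.2.2.resolve_right fun h' => ?_
        obtain ⟨N, hN⟩ := h
        obtain ⟨M, hM⟩ := h'
        obtain ⟨g, hg, k, -, _, e⟩ := hN (max N M) (le_max_left _ _)
        exact (hM _ (le_max_right _ _) g hg).2 (congrArg Quiver.Total.right e).symm
      · refine V.2.2.resolve_right fun h' => ?_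
        obtain ⟨N, hN⟩ := h
        obtain ⟨M, hM⟩ := h'
        obtain ⟨g, -, k, hk, _, e⟩ := hN (max N M) (le_max_left _ _)
        exact (hM _ (le_max_right _ _) k hk).1 (congrArg Quiver.Total.left e).symm
  map_zero := by
    apply BisectionSemigroup.ext
    rw [carrier_zero]
    refine eq_empty_of_forall_notMem ?_
    rintro k (⟨n, m, -, g, hg, -⟩ | ⟨-, N, hN⟩)
    · exact hg
    · exact hN N le_rfl
  map_join U V W h hW := by
    have hW := isJoin_iff.1 ((isJoin_coe h).1 hW)
    refine isJoin_iff.2 ?_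
    change traceSet x W.1.carrier = traceSet x U.1.carrier ∪ traceSet x V.1.carrier
    rw [hW]
    refine TOneUnits.set_ext (fun n m => ?_) ?_
    · simp only [mem_union, arr_mem_traceSet]
      constructor
      · rintro ⟨g, hg | hg, e⟩
        · exact Or.inl ⟨g, hg, e⟩
        · exact Or.inr ⟨g, hg, e⟩
      · rintro (⟨g, hg, e⟩ | ⟨g, hg, e⟩)
        · exact ⟨g, Or.inl hg, e⟩
        · exact ⟨g, Or.inr hg, e⟩
    · rw [mem_union]
      simp only [arrInfty_mem_traceSet]
      constructor
      · intro h
        -- If neither part has a unit tail, both have empty tails, and so does their union.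
        by_contra! hc
        exact h.not_hasEmptyTail ((U.2.2.resolve_left hc.1).union (V.2.2.resolve_left hc.2))
      · rintro (h | h)
        · exact h.mono subset_union_left
        · exact h.mono subset_union_right

/-- The disjoint clopen `D n` keep the lifts of different arrows apart, and the compact open `K`
contains the whole sequence, so that a unit tail can be lifted to a compact set. -/
theorem surjective_trace {x : ℕ → X} (hx : Function.Injective x) {K : Set X} (hK : IsCompact K)
    (hKo : IsOpen K) (hxK : ∀ n, x n ∈ K) {D : ℕ → Set X} (hDo : ∀ n, IsOpen (D n))
    (hDc : ∀ n, IsClosed (D n)) (hxD : ∀ n, x n ∈ D n) (hD : ∀ n m z, z ∈ D n → z ∈ D m → n = m)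
    (hxx : ∀ n m, x m ∈ orbit (x n)) : Function.Surjective (trace x hx) := by
  intro W
  have hB : ∀ n m, ∃ B : BisectionSemigroup X,
      (∀ g ∈ B.carrier, g.left ∈ D n ∧ g.right ∈ D m) ∧
      ∃ g ∈ B.carrier, g.left = x n ∧ g.right = x m := by
    intro n m
    obtain ⟨g, h1, h2⟩ := hxx n m
    obtain ⟨B, hg, hB⟩ := exists_bisection_subset (g := g)
      (((hDo n).preimage IsTopologicalGroupoid.continuous_source).inter
        ((hDo m).preimage IsTopologicalGroupoid.continuous_range))
      ⟨show g.left ∈ D n from h1 ▸ hxD n, show g.right ∈ D m from h2 ▸ hxD m⟩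
    exact ⟨B, fun k hk => hB hk, g, hg, h1, h2⟩
  choose B hBD hBx using hB
  obtain ⟨N, hN, hW⟩ := TOneUnits.exists_tail W
  -- `T` carries the units lifting the tail of `W`: `K` with the first `N` sets `D n` removed, or
  -- empty when `W` misses infinity.
  obtain ⟨T, hTc, hTo, hTD, hT⟩ : ∃ T : Set X, IsCompact T ∧ IsOpen T ∧
      (∀ z ∈ T, ∀ n < N, z ∉ D n) ∧
      ((TOneUnits.arrInfty ∈ W.carrier ∧ ∀ n ≥ N, x n ∈ T) ∨
        (TOneUnits.arrInfty ∉ W.carrier ∧ T = ∅)) := by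
    rcases hW with ⟨hW, -⟩ | ⟨hW, -⟩
    · refine ⟨K \ ⋃ n ∈ Iio N, D n, hK.diff (isOpen_biUnion fun n _ => hDo n),
        hKo.sdiff ((finite_Iio N).isClosed_biUnion fun n _ => hDc n),
        fun z hz n hn hz' => hz.2 (mem_biUnion (mem_Iio.2 hn) hz'),
        Or.inl ⟨hW, fun n hn => ⟨hxK n, fun h => ?_⟩⟩⟩
      obtain ⟨m, hm, hz⟩ := mem_iUnion₂.1 h
      exact (not_lt.2 hn) (hD m n _ hz (hxD n) ▸ hm)
    · exact ⟨∅, isCompact_empty, isOpen_empty, fun _ h => h.elim, Or.inr ⟨hW, rfl⟩⟩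
  let S : Set (ℕ × ℕ) := {p | p.1 < N ∧ TOneUnits.arr p.1 p.2 ∈ W.carrier}
  have hS : S.Finite := by
    refine Finite.of_finite_image (f := Prod.fst) ((finite_lt_nat N).subset ?_) ?_
    · rintro _ ⟨p, hp, rfl⟩
      exact hp.1
    · rintro ⟨n, m⟩ hp ⟨n', m'⟩ hq e
      obtain rfl : n = n' := e
      have := W.isBisection.eq_of_left hp.2 hq.2 rfl
      exact Prod.ext rfl (TOneUnits.arr_inj.1 this).2
  -- The lift of `W`: a small bisection from `D n` to `D m` for each arrow `n → m` with `n < N`, and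
  -- the units over `T`.
  let Y : Set (Quiver.Total X) := (⋃ p ∈ S, (B p.1 p.2).carrier) ∪ unitArr '' T
  have hY : ∀ g, g ∈ Y ↔ (∃ n m, n < N ∧ TOneUnits.arr n m ∈ W.carrier ∧ g ∈ (B n m).carrier) ∨
      ∃ z ∈ T, unitArr z = g := by
    intro g
    simp [Y, S, and_assoc]
  have hYo : IsOpen Y := (isOpen_biUnion fun p _ => (B p.1 p.2).isOpen).union
    (isOpenEmbedding_unitArr.isOpenMap T hTo)
  have hYb : IsBisection Y := by
    rw [isBisection_iff hYo]
    constructor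
    · intro g hg k hk e
      rcases (hY g).1 hg with ⟨n, m, hn, hnm, hg⟩ | ⟨z, hz, rfl⟩ <;>
        rcases (hY k).1 hk with ⟨n', m', hn', hnm', hk⟩ | ⟨z', hz', rfl⟩
      · obtain rfl := hD n n' _ (hBD n m g hg).1 (e ▸ (hBD n' m' k hk).1)
        obtain rfl := (TOneUnits.arr_inj.1 (W.isBisection.eq_of_left hnm hnm' rfl)).2
        exact (B n m).isBisection.eq_of_left hg hk e
      · have e : g.left = z' := e
        exact (hTD z' hz' n hn (e ▸ (hBD n m g hg).1)).elim
      · have e : z = k.left := e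
        exact (hTD z hz n' hn' (e ▸ (hBD n' m' k hk).1)).elim
      · have e : z = z' := e
        rw [e]
    · intro g hg k hk e
      rcases (hY g).1 hg with ⟨n, m, hn, hnm, hg⟩ | ⟨z, hz, rfl⟩ <;>
        rcases (hY k).1 hk with ⟨n', m', hn', hnm', hk⟩ | ⟨z', hz', rfl⟩
      · obtain rfl := hD m m' _ (hBD n m g hg).2 (e ▸ (hBD n' m' k hk).2)
        obtain rfl := (TOneUnits.arr_inj.1 (W.isBisection.eq_of_right hnm hnm' rfl)).1
        exact (B n m).isBisection.eq_of_right hg hk e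
      · have e : g.right = z' := e
        exact (hTD z' hz' m (hN n m hnm hn) (e ▸ (hBD n m g hg).2)).elim
      · have e : z = k.right := e
        exact (hTD z hz m' (hN n' m' hnm' hn') (e ▸ (hBD n' m' k hk).2)).elim
      · have e : z = z' := e
        rw [e]
  have hYc : IsCompact Y := (hS.isCompact_biUnion fun p _ => (B p.1 p.2).isCompact).union
    (hTc.image isOpenEmbedding_unitArr.continuous)
  -- `D n` contains no term but `x n`, and `B n m` is a bisection, so its only arrow touching the
  -- sequence at its source (or at its range) is the chosen one from `x n` to `x m`.
  have hends : ∀ n m g, g ∈ (B n m).carrier → ∀ l,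
      (g.left = x l → l = n ∧ g.right = x m) ∧ (g.right = x l → l = m ∧ g.left = x n) := by
    intro n m g hg l
    obtain ⟨k, hk, h1, h2⟩ := hBx n m
    constructor
    · intro e
      obtain rfl := hD l n (x l) (hxD l) (e ▸ (hBD n m g hg).1)
      rw [(B l m).isBisection.eq_of_left hg hk (e.trans h1.symm)]
      exact ⟨rfl, h2⟩
    · intro e
      obtain rfl := hD l m (x l) (hxD l) (e ▸ (hBD n m g hg).2)
      rw [(B n l).isBisection.eq_of_right hg hk (e.trans h2.symm)]
      exact ⟨rfl, h1⟩
  have hYp : PreservesRange x Y := by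
    intro g hg
    rcases (hY g).1 hg with ⟨n, m, -, -, hg⟩ | ⟨z, hz, rfl⟩
    · constructor
      · rintro ⟨l, e⟩
        exact ⟨m, ((hends n m g hg l).1 e.symm).2.symm⟩
      · rintro ⟨l, e⟩
        exact ⟨n, ((hends n m g hg l).2 e.symm).2.symm⟩
    · exact Iff.rfl
  have hYt : (TOneUnits.arrInfty ∈ W.carrier ∧ HasUnitTail x Y) ∨
      (TOneUnits.arrInfty ∉ W.carrier ∧ HasEmptyTail x Y) := by
    refine hT.imp (And.imp_right fun h => ⟨N, fun n hn => Or.inr ⟨_, h n hn, rfl⟩⟩)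
      (And.imp_right fun h => ⟨N, fun l hl g hg => ?_⟩)
    rcases (hY g).1 hg with ⟨n, m, hn, hnm, hg⟩ | ⟨z, hz, rfl⟩
    · constructor
      · intro e
        have := ((hends n m g hg l).1 e).1
        omega
      · intro e
        have := ((hends n m g hg l).2 e).1
        have := hN n m hnm hn
        omega
    · rw [h] at hz
      exact hz.elim
  refine ⟨⟨⟨Y, hYc, hYo, hYb⟩, hYp, hYt.imp And.right And.right⟩, BisectionSemigroup.ext ?_⟩
  change traceSet x Y = W.carrier
  refine TOneUnits.set_ext (fun n m => ?_) ?_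
  · rw [arr_mem_traceSet]
    constructor
    · rintro ⟨g, hg, h1, h2⟩
      rcases (hY g).1 hg with ⟨n', m', hn, hnm, hg⟩ | ⟨z, hz, rfl⟩
      · rwa [((hends n' m' g hg n).1 h1).1, ((hends n' m' g hg m).2 h2).1]
      · have h1 : z = x n := h1
        have h2 : z = x m := h2
        obtain rfl := hx (h1.symm.trans h2)
        have hn : N ≤ n := by
          by_contra hn
          exact hTD z hz n (not_le.1 hn) (h1 ▸ hxD n)
        rcases hT with ⟨hT, -⟩ | ⟨-, hT⟩
        · rcases hW with ⟨-, hW⟩ | ⟨hW, -⟩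
          · exact (hW n hn n).2 rfl
          · exact (hW hT).elim
        · rw [hT] at hz
          exact hz.elim
    · intro h
      by_cases hn : n < N
      · obtain ⟨g, hg, e⟩ := hBx n m
        exact ⟨g, (hY g).2 (Or.inl ⟨n, m, hn, h, hg⟩), e⟩
      · rcases hW with ⟨hW, hW'⟩ | ⟨-, hW⟩
        · obtain rfl := (hW' n (not_lt.1 hn) m).1 h
          rcases hT with ⟨-, hT⟩ | ⟨hT, -⟩
          · exact ⟨unitArr (x m), Or.inr ⟨_, hT m (not_lt.1 hn), rfl⟩, rfl, rfl⟩
          · exact (hT hW).elim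
        · exact (hW n (not_lt.1 hn) m h).elim
  · rw [arrInfty_mem_traceSet]
    rcases hYt with ⟨h1, h2⟩ | ⟨h1, h2⟩
    · exact iff_of_true h2 h1
    · exact iff_of_false (fun h => h.not_hasEmptyTail h2) h1

theorem hasSubquotient_of_infinite {K : Set X} (hK : IsCompact K) (hKo : IsOpen K) {x₀ : X}
    (h : (orbit x₀ ∩ K).Infinite) : HasSubquotient (BisectionSemigroup X) BTOne := by
  have := t2_units (X := X)
  have := h.to_subtype
  -- An infinite Hausdorff space contains a copy of the discrete space `ℕ`.
  obtain ⟨f, hf⟩ := exists_topology_isEmbedding_nat (X := (orbit x₀ ∩ K : Set X))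
  let x : ℕ → X := fun n => (f n).1
  have hxe : IsEmbedding x := IsEmbedding.subtypeVal.comp hf
  have hV : ∀ n, ∃ V : Set X, IsCompact V ∧ IsOpen V ∧ x n ∈ V ∧ ∀ m, x m ∈ V → m = n := by
    intro n
    obtain ⟨O, hO, hO'⟩ := hxe.isInducing.isOpen_iff.1 (isOpen_discrete {n})
    obtain ⟨V, hVO, h1, h2, h3⟩ := exists_compact_open_units hO
      (show x n ∈ O from show n ∈ x ⁻¹' O from hO' ▸ rfl)
    refine ⟨V, h1, h2, h3, fun m hm => ?_⟩
    have : m ∈ x ⁻¹' O := hVO hm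
    rwa [hO'] at this
  choose V hVc hVo hxV hV using hV
  refine ⟨tailSubsemigroup x, trace x hxe.injective, isBooleanMorphism_trace _ _,
    surjective_trace hxe.injective hK hKo (fun n => (f n).2.2)
      -- Each `V n` isolates `x n` in the sequence; removing the finitely many earlier ones makes
      -- them disjoint, keeps them clopen and does not lose `x n`.
      (D := fun n => V n \ ⋃ m ∈ Iio n, V m) ?_ ?_ ?_ ?_ ?_⟩
  · exact fun n => (hVo n).sdiff ((finite_Iio n).isClosed_biUnion fun m _ => (hVc m).isClosed)
  · exact fun n => ((hVc n).diff (isOpen_biUnion fun m _ => hVo m)).isClosed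
  · refine fun n => ⟨hxV n, fun h => ?_⟩
    obtain ⟨m, hm, hz⟩ := mem_iUnion₂.1 h
    exact (mem_Iio.1 hm).ne' (hV m n hz)
  · intro n m z hn hm
    rcases lt_trichotomy n m with h | h | h
    · exact (hm.2 (mem_biUnion (mem_Iio.2 h) hn.1)).elim
    · exact h
    · exact (hn.2 (mem_biUnion (mem_Iio.2 h) hm.1)).elim
  · intro n m
    exact orbit_trans (orbit_symm (f n).2.1) (f m).2.1

theorem infinite_orbit_inter_of_not_isClosed {x₀ : X} (h : ¬ IsClosed (orbit x₀)) :
    ∃ K : Set X, IsCompact K ∧ IsOpen K ∧ (orbit x₀ ∩ K).Infinite := by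
  have := t2_units (X := X)
  obtain ⟨y, hy, hy'⟩ : ∃ y ∈ closure (orbit x₀), y ∉ orbit x₀ := by
    by_contra! hc
    exact h (isClosed_of_closure_subset hc)
  obtain ⟨K, -, hK, hKo, hyK⟩ := exists_compact_open_units isOpen_univ (mem_univ y)
  refine ⟨K, hK, hKo, fun hfin => ?_⟩
  obtain ⟨z, hz, hz'⟩ := mem_closure_iff.1 hy (K \ (orbit x₀ ∩ K))
    (hKo.sdiff hfin.isClosed) ⟨hyK, fun h => hy' h.1⟩
  exact hz.2 ⟨hz', hz.1⟩

end Ample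

/-! ### Closed orbits in the second countable case. -/

section Ample

variable {X : Type u} [Groupoid.{v} X] [TopologicalSpace X] [TopologicalSpace (Quiver.Total X)]

/-- Countably many bisections cover the arrows, and each contains at most one arrow starting at `x`.
-/
theorem countable_orbit [IsAmpleGroupoid X] [SecondCountableTopology (Quiver.Total X)] (x : X) :
    (orbit x).Countable := by
  choose B hB using fun g : Quiver.Total X => exists_bisection_subset isOpen_univ (mem_univ g)
  obtain ⟨s, hs, hsU⟩ := TopologicalSpace.countable_cover_nhds
    fun g => (B g).isOpen.mem_nhds (hB g).1
  refine (hs.biUnion (t := fun g _ => Quiver.Total.right '' {k ∈ (B g).carrier | k.left = x})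
    fun g _ => ?_).mono ?_
  · refine (Set.Subsingleton.image ?_ _).countable
    rintro k ⟨hk, e⟩ l ⟨hl, e'⟩
    exact (B g).isBisection.eq_of_left hk hl (e.trans e'.symm)
  · rintro _ ⟨g, h1, rfl⟩
    have : g ∈ ⋃ k ∈ s, (B k).carrier := hsU ▸ mem_univ g
    obtain ⟨k, hk, hg⟩ := mem_iUnion₂.1 this
    exact mem_iUnion₂.2 ⟨k, hk, g, ⟨hg, h1⟩, rfl⟩

/-- If one point of an orbit is isolated in the orbit, then all are. -/
theorem exists_open_inter_orbit_eq [IsAmpleGroupoid X] {x y z : X} (hy : y ∈ orbit x)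
    (hz : z ∈ orbit x) {V : Set X} (hV : IsOpen V) (hVy : V ∩ orbit x = {y}) :
    ∃ W, IsOpen W ∧ W ∩ orbit x = {z} := by
  have hyV : y ∈ V := inter_subset_left (hVy ▸ mem_singleton y)
  obtain ⟨g, rfl, rfl⟩ := orbit_trans (orbit_symm hz) hy
  -- `g` goes from `z` to `y`. A bisection around it with ranges in `V` transports the isolating
  -- neighbourhood of `y` to its set of sources.
  obtain ⟨B, hg, hB⟩ := exists_bisection_subset (g := g)
    (hV.preimage IsTopologicalGroupoid.continuous_range) hyV
  refine ⟨_, IsEtaleGroupoid.etale.isOpenMap _ B.isOpen, Subset.antisymm ?_ ?_⟩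
  · rintro _ ⟨⟨k, hk, rfl⟩, hk'⟩
    have : k.right ∈ V ∩ orbit x := ⟨hB hk, orbit_trans hk' ⟨k, rfl, rfl⟩⟩
    rw [hVy] at this
    rw [B.isBisection.eq_of_right hk hg this]
    rfl
  · rintro _ rfl
    exact ⟨⟨g, hg, rfl⟩, hz⟩

theorem finite_orbit_inter [IsAmpleGroupoid X] [T2Space (Quiver.Total X)]
    [SecondCountableTopology (Quiver.Total X)] {x : X} (hx : IsClosed (orbit x)) {K : Set X}
    (hK : IsCompact K) (hKo : IsOpen K) : (orbit x ∩ K).Finite := by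
  have := t2_units (X := X)
  have hS : IsCompact (orbit x ∩ K) := hK.inter_left hx
  have := isCompact_iff_compactSpace.1 hS
  have := ((countable_orbit x).mono (inter_subset_left (t := K))).to_subtype
  rcases (orbit x ∩ K).eq_empty_or_nonempty with h0 | h0
  · rw [h0]
    exact finite_empty
  have := h0.to_subtype
  -- Baire: a nonempty countable compact Hausdorff space is a countable union of closed points, so
  -- one of them is open.
  obtain ⟨y, hy⟩ := nonempty_interior_of_iUnion_of_closed
    (f := fun y : (orbit x ∩ K : Set X) => ({y} : Set (orbit x ∩ K : Set X)))
    (fun _ => isClosed_singleton) (iUnion_of_singleton _)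
  have hyo : IsOpen ({y} : Set (orbit x ∩ K : Set X)) := by
    rw [← hy.subset_singleton_iff.1 interior_subset]
    exact isOpen_interior
  obtain ⟨V, hV, hVy⟩ := isOpen_induced_iff.1 hyo
  -- Openness of `K` upgrades isolation in `orbit x ∩ K` to isolation in the whole orbit, which can
  -- be moved along arrows.
  have hVK : (V ∩ K) ∩ orbit x = {y.1} := by
    ext z
    constructor
    · rintro ⟨⟨h1, h2⟩, h3⟩
      have : (⟨z, h3, h2⟩ : (orbit x ∩ K : Set X)) ∈ Subtype.val ⁻¹' V := h1
      rw [hVy] at this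
      exact congrArg Subtype.val this
    · rintro rfl
      have : y ∈ Subtype.val ⁻¹' V := hVy ▸ mem_singleton y
      exact ⟨⟨this, y.2.2⟩, y.2.1⟩
  have : DiscreteTopology (orbit x ∩ K : Set X) := by
    refine discreteTopology_iff_isOpen_singleton.2 fun z => ?_
    obtain ⟨W, hW, hWz⟩ := exists_open_inter_orbit_eq y.2.1 z.2.1 (hV.inter hKo) hVK
    refine isOpen_induced_iff.2 ⟨W, hW, Subset.antisymm ?_ ?_⟩
    · intro w hw
      have : w.1 ∈ W ∩ orbit x := ⟨hw, w.2.1⟩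
      rw [hWz] at this
      exact Subtype.ext this
    · rintro w hw
      obtain rfl : w = z := hw
      exact (show w.1 ∈ W ∩ orbit x from hWz ▸ mem_singleton w.1).1
  have : Finite (orbit x ∩ K : Set X) := finite_of_compact_of_discrete
  exact toFinite _

/-! ### From the subquotient `B_(T1)` to an infinite piece of an orbit. -/

variable [IsAmpleGroupoid X] [T2Space (Quiver.Total X)]

open BisectionSemigroup InverseSemigroupWithZero

theorem IsBooleanMorphism.map_inv {S : Type u} {T : Type v} [BooleanInverseSemigroup S]
    [BooleanInverseSemigroup T] {φ : S → T} (hφ : IsBooleanMorphism φ) (s : S) :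
    φ s⁻¹ = (φ s)⁻¹ := by
  apply eq_inv
  · rw [← hφ.map_mul, ← hφ.map_mul, mul_inv_mul_self]
  · rw [← hφ.map_mul, ← hφ.map_mul, inv_mul_inv_self]

theorem IsBooleanMorphism.map_supp {S : Type u} {T : Type v} [BooleanInverseSemigroup S]
    [BooleanInverseSemigroup T] {φ : S → T} (hφ : IsBooleanMorphism φ) (s : S) :
    φ (supp s) = supp (φ s) := by
  rw [supp, hφ.map_mul, hφ.map_inv, supp]

/-- A morphism from a subsemigroup of `Γ(G)` to `Γ(H)` pulls a unit of `H` back to a unit of `G`,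
as soon as the unit of `H` lies in the image of an idempotent. -/
theorem exists_unit_of_isBooleanMorphism {Y : Type*} [Groupoid Y] [TopologicalSpace Y]
    [TopologicalSpace (Quiver.Total Y)] [IsAmpleGroupoid Y] [T2Space (Quiver.Total Y)]
    {C : BooleanInverseSubsemigroup (BisectionSemigroup X)}
    {π : C.carrier → BisectionSemigroup Y} (hπ : IsBooleanMorphism π) {y : Y} {e : C.carrier}
    (he : e * e = e) (hye : unitArr y ∈ (π e).carrier) :
    ∃ x : X, ∀ f : C.carrier, f * f = f →
      (unitArr x ∈ f.1.carrier ↔ unitArr y ∈ (π f).carrier) := by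
  have hval : ∀ {f : C.carrier}, f * f = f → f.1 * f.1 = f.1 := fun h => congrArg Subtype.val h
  have hπi : ∀ {f : C.carrier}, f * f = f → π f * π f = π f := fun h => by rw [← hπ.map_mul, h]
  -- The idempotents of `C` whose image contains `y` form a filter of nonempty compact sets,
  -- directed under products; a point of the intersection is the desired unit.
  let F : Set (Set (Quiver.Total X)) :=
    {A | ∃ f : C.carrier, f * f = f ∧ unitArr y ∈ (π f).carrier ∧ A = f.1.carrier}
  obtain ⟨k, hk⟩ : (⋂₀ F).Nonempty := by
    have : Nonempty F := ⟨⟨_, e, he, hye, rfl⟩⟩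
    refine IsCompact.nonempty_sInter_of_directed_nonempty_isCompact_isClosed ?_ ?_ ?_ ?_
    · rintro _ ⟨f, hf, hyf, rfl⟩ _ ⟨f', hf', hyf', rfl⟩
      refine ⟨_, ⟨f * f', idem_mul hf hf', ?_, rfl⟩, ?_, ?_⟩
      · rw [hπ.map_mul, carrier_mul_of_idem (hπi hf) (hπi hf')]
        exact ⟨hyf, hyf'⟩
      · change (f.1 * f'.1).carrier ⊆ _
        rw [carrier_mul_of_idem (hval hf) (hval hf')]
        exact inter_subset_left
      · change (f.1 * f'.1).carrier ⊆ _
        rw [carrier_mul_of_idem (hval hf) (hval hf')]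
        exact inter_subset_right
    · rintro _ ⟨f, hf, hyf, rfl⟩
      by_contra hc
      have : f = 0 := Subtype.ext (BisectionSemigroup.ext (not_nonempty_iff_eq_empty.1 hc))
      rw [this, hπ.map_zero] at hyf
      exact hyf
    · rintro _ ⟨f, -, -, rfl⟩
      exact f.1.isCompact
    · rintro _ ⟨f, -, -, rfl⟩
      exact f.1.isCompact.isClosed
  have hku : k = unitArr k.left := mem_of_idem (hval he) (hk _ ⟨e, he, hye, rfl⟩)
  refine ⟨k.left, fun f hf => ⟨fun hkf => ?_, fun hyf => ?_⟩⟩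
  · by_contra hyf
    rw [← hku] at hkf
    -- The filter is prime: `e` is the orthogonal join of `e \ f` and `e f`. If `y` is not in `π f`,
    -- then it lies in `π (e \ f)`, so `k` lies in `e \ f` and cannot lie in `f`.
    obtain ⟨d, hd, hdc⟩ := exists_isRelCompl (hval hf) (hval he)
    let d' : C.carrier := ⟨d, C.relCompl_mem f.2 e.2 (hval hf) (hval he) hd⟩
    have hd' : d' * d' = d' := Subtype.ext hd.1.1
    have hef : (e * f) * (e * f) = e * f := idem_mul he hf
    have hort : Orthogonal d' (e * f) := by
      have h0 : d' * (e * f) = 0 := by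
        rw [idem_comm he hf, ← mul_assoc]
        have : d' * f = 0 := Subtype.ext hd.1.2.2
        rw [this, zero_mul]
      rw [Orthogonal, inv_of_idem hd', inv_of_idem hef]
      exact ⟨h0, h0⟩
    have hj : IsJoin d' (e * f) e := by
      rw [isJoin_coe hort, isJoin_iff]
      change _ = d.carrier ∪ (e.1 * f.1).carrier
      rw [hdc, carrier_mul_of_idem (hval he) (hval hf), sdiff_union_inter]
    have hj' := isJoin_iff.1 (hπ.map_join _ _ _ hort hj)
    rw [hj', hπ.map_mul, carrier_mul_of_idem (hπi he) (hπi hf)] at hye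
    have hyd : unitArr y ∈ (π d').carrier := hye.resolve_right fun h => hyf h.2
    have := hk _ ⟨d', hd', hyd, rfl⟩
    change k ∈ d.carrier at this
    rw [hdc] at this
    exact this.2 hkf
  · rw [← hku]
    exact hk _ ⟨f, hf, hyf, rfl⟩

/-- Lifts of the arrows `0 → n` give arrows out of a single unit `x`. Their ranges differ because
the products `(W m)⁻¹ * W n` are zero for `n ≠ m`. -/
theorem exists_infinite_of_hasSubquotient (h : HasSubquotient (BisectionSemigroup X) BTOne) :
    ∃ (x : X) (K : Set X), IsCompact K ∧ IsOpen K ∧ (orbit x ∩ K).Infinite := by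
  obtain ⟨C, π, hπ, hs⟩ := h
  let W (n : ℕ) : BTOne :=
    ⟨{TOneUnits.arr 0 n}, isCompact_singleton, TOneUnits.isOpen_singleton
      (TOneUnits.fin_ne_infty 0), (isBisection_iff (TOneUnits.isOpen_singleton
        (TOneUnits.fin_ne_infty 0))).2 ⟨injOn_singleton _ _, injOn_singleton _ _⟩⟩
  let I : BTOne := ⟨range unitArr, isCompact_range TOneUnits.isOpenEmbedding_unitArr.continuous,
    TOneUnits.isOpen_range_unitArr, isBisection_of_units TOneUnits.isOpen_range_unitArr (by
      rintro _ ⟨z, rfl⟩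
      rfl)⟩
  have hIW : ∀ n, I * W n = W n := by
    intro n
    apply BisectionSemigroup.ext
    ext k
    constructor
    · rintro ⟨_, ⟨z, rfl⟩, _, rfl, w, rfl⟩
      exact TOneUnits.arr_ext rfl w.symm
    · rintro rfl
      exact ⟨_, ⟨TOneUnits.fin n, rfl⟩, _, rfl, rfl, TOneUnits.arr_ext rfl rfl⟩
  obtain ⟨e, he⟩ := hs I
  have hv : ∀ n, ∃ v : C.carrier, π v = W n ∧
      ∀ g ∈ v.1.carrier, g.right ∈ Quiver.Total.right '' e.1.carrier := by
    intro n
    obtain ⟨u, hu⟩ := hs (W n)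
    -- Multiplying by a lift `e` of the identity keeps the image and confines all ranges to the
    -- compact open set `r(e)`, independent of `n`.
    refine ⟨e * u, by rw [hπ.map_mul, he, hu, hIW], ?_⟩
    rintro _ ⟨a, ha, b, -, -, rfl⟩
    exact ⟨a, ha, rfl⟩
  choose v hvW hvK using hv
  obtain ⟨x, hx⟩ := exists_unit_of_isBooleanMorphism hπ (y := TOneUnits.fin 0)
    (supp_idem (v 0)) (by
    rw [hπ.map_supp, hvW, carrier_supp]
    exact ⟨_, rfl, rfl⟩)
  -- Applying the correspondence of units to supports extends it from idempotents to all of `C`.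
  have hxs : ∀ u : C.carrier, (∃ g ∈ u.1.carrier, g.left = x) ↔
      ∃ k ∈ (π u).carrier, k.left = TOneUnits.fin 0 := by
    intro u
    have := hx _ (supp_idem u)
    rw [hπ.map_supp, C.coe_supp, carrier_supp, carrier_supp] at this
    constructor
    · rintro ⟨g, hg, rfl⟩
      obtain ⟨k, hk, h⟩ := this.1 ⟨g, hg, rfl⟩
      exact ⟨k, hk, congrArg Quiver.Total.left h⟩
    · rintro ⟨k, hk, h⟩
      obtain ⟨g, hg, h⟩ := this.2 ⟨k, hk, congrArg unitArr h⟩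
      exact ⟨g, hg, congrArg Quiver.Total.left h⟩
  have hg : ∀ n, ∃ g ∈ (v n).1.carrier, g.left = x := fun n =>
    (hxs (v n)).2 ⟨TOneUnits.arr 0 n, by rw [hvW]; rfl, rfl⟩
  choose g hgv hgx using hg
  refine ⟨x, _, e.1.isCompact.image IsTopologicalGroupoid.continuous_range,
    isLocalHomeomorph_range.isOpenMap _ e.1.isOpen,
    infinite_of_injective_forall_mem (f := fun n => (g n).right) ?_
      fun n => ⟨⟨g n, hgx n, rfl⟩, hvK n _ (hgv n)⟩⟩
  intro n m hnm
  have hnm : (g n).right = (g m).right := hnm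
  -- Equal ranges make `(g m)⁻¹ (g n)` an arrow of `(v m)⁻¹ * v n` starting at `x`. Its image `(W
  -- m)⁻¹ * W n` is then nonempty, which forces `n = m`.
  obtain ⟨k, hk, hk0⟩ := (hxs ((v m)⁻¹ * v n)).1 ⟨mulArr (invArr (g m)) (g n) hnm,
    ⟨_, by
      change invArr (invArr (g m)) ∈ (v m).1.carrier
      rw [invArr_invArr]
      exact hgv m, _, hgv n, hnm, rfl⟩, hgx n⟩
  rw [hπ.map_mul, hπ.map_inv, hvW, hvW] at hk
  obtain ⟨a, ha, b, hb, w, -⟩ := hk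
  obtain rfl : b = TOneUnits.arr 0 n := hb
  have ha : invArr a = TOneUnits.arr 0 m := ha
  exact TOneUnits.fin_injective (w.trans (congrArg Quiver.Total.right ha))

end Ample

end NCStone

theorem mainTheorem5 {X : Type u} [Groupoid.{v} X] [TopologicalSpace X]
    [TopologicalSpace (Quiver.Total X)] [NCStone.IsAmpleGroupoid X] [T2Space (Quiver.Total X)] :
    (¬ T1Space (NCStone.OrbitSpace X) →
      NCStone.HasSubquotient (NCStone.BisectionSemigroup X) NCStone.BTOne) ∧
    (SecondCountableTopology (Quiver.Total X) →
      NCStone.HasSubquotient (NCStone.BisectionSemigroup X) NCStone.BTOne →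
      ¬ T1Space (NCStone.OrbitSpace X)) := by
  constructor
  · intro h
    rw [NCStone.t1Space_orbitSpace_iff] at h
    push Not at h
    obtain ⟨x, hx⟩ := h
    obtain ⟨K, hK, hKo, hinf⟩ := NCStone.infinite_orbit_inter_of_not_isClosed hx
    exact NCStone.hasSubquotient_of_infinite hK hKo hinf
  · intro _ h hT
    obtain ⟨x, K, hK, hKo, hinf⟩ := NCStone.exists_infinite_of_hasSubquotient h
    exact hinf (NCStone.finite_orbit_inter (NCStone.t1Space_orbitSpace_iff.1 hT x) hK hKo)
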